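/- **Setting.** Let $dx$ be the surface measure on $\mathbb S^2$ (total mass $4\pi$) and let $\{Y_{\ell,m}:\ell\ge 0,\ m=-\ell,\dots,\ell\}$ be an orthonormal basis of real spherical harmonics: for each $\ell$ the functions $Y_{\ell,m}$ are restrictions to $\mathbb S^2$ of homogeneous harmonic polynomials of degree $\ell$, and the whole family is orthonormal in $L^2(\mathbb S^2,dx)$. Let $p\ge 1$. On a probability space consider real random fields $T,Z$ on $\mathbb S^2\times\mathbb Z$ (measurable jointly in the space variable and the outcome) such that: * $Z$ is a Gaussian spherical white noise with angular power spectrum $(C_{\ell;Z})_{\ell\ge0}$: the fields $Z(\cdot,t)$, $t\in\mathbb Z$, are i.i.d., Gaussian, centered, isotropic, with covariance $$\Gamma_Z(x,y)=\mathbb E[Z(x,t)Z(y,t)]=\sum_{\ell\ge 0}C_{\ell;Z}\sum_{m=-\ell}^{\ell}Y_{\ell,m}(x)Y_{\ell,m}(y)=\sum_{\ell\ge0}\frac{2\ell+1}{4\pi}C_{\ell;Z}P_\ell(\langle x,y\rangle),\qquad \sum_{\ell\ge 0}\frac{2\ell+1}{4\pi}C_{\ell;Z}<\infty,$$ where $P_\ell$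 is the Legendre polynomial of degree $\ell$. * $T$ is a Gaussian, centered, mean-square continuous field, isotropic in space and stationary in time, i.e. $T(R\,\cdot,\cdot+\tau)$ and $T(\cdot,\cdot)$ have the same law for all $R\in SO(3)$, $\tau\in\mathbb Z$. * $T$ solves the spherical autoregression of order $p$ $$T(x,t)=\sum_{j=1}^{p}(\Phi_jT(\cdot,t-j))(x)+Z(x,t),\qquad (\Phi_jf)(x)=\int_{\mathbb S^2}k_j(\langle x,y\rangle)f(y)\,dy,$$ with $k_j:[-1,1]\to\mathbb R$ continuous (for each $t$, almost surely, for almost every $x$). Let $\phi_{\ell;j}$ be the eigenvalue of $\Phi_j$ on the spherical harmonics of degree $\ell$, $\Phi_jY_{\ell,m}=\phi_{\ell;j}Y_{\ell,m}$, and put $\boldsymbol\phi_\ell=(\phi_{\ell;1},\dots,\phi_{\ell;p})'$, $\phi_\ell(z)=1-\sum_{j=1}^p\phi_{\ell;j}z^j$, $\mu_{\min;\ell}=\min_{|z|=1}|\phi_\ell(z)|^2$, $\mu_{\max;\ell}=\max_{|z|=1}|\phi_\ell(z)|^2$. Assume * (identifiability) $\int_{\mathbb S^2\times\mathbb S^2}\Gamma_Z(x,y)f(x)f(y)\,dx\,dy>0$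 for every nonzero $f\in L^2(\mathbb S^2)$; * (stationarity) $\phi_\ell(z)\neq0$ for all $|z|\le1$ and all $\ell\ge0$. For $N\ge1$ and $n=N+p$ let $a_{\ell,m}(t)=\int_{\mathbb S^2}T(x,t)Y_{\ell,m}(x)\,dx$. Let $\mathbf Y_{\ell,N}\in\mathbb R^{N(2\ell+1)}$ be the vector with entries $a_{\ell,m}(t)$, and $X_{\ell,N}$ the $N(2\ell+1)\times p$ matrix whose $h$-th column has entries $a_{\ell,m}(t-h)$, where $t=n,\dots,p+1$ and $m=-\ell,\dots,\ell$. Put $$\widehat\gamma_{\ell,N}=\frac{X_{\ell,N}'\mathbf Y_{\ell,N}}{N(2\ell+1)},\qquad \widehat\Gamma_{\ell,N}=\frac{X_{\ell,N}'X_{\ell,N}}{N(2\ell+1)}.$$ **Proposition (Deviation condition).** For every $\kappa>0$ there exist constants $c_0,c_1,c_2>0$, depending only on $\kappa$, such that in every model as above, for all integers $N\ge1$ and $L_N\ge1$ with $N\ge\kappa\log(pL_N)$, $$\mathbb P\Big(\|\widehat\gamma_{\ell,N}-\widehat\Gamma_{\ell,N}\boldsymbol\phi_\ell\|_\infty\le\mathcal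 F_N\sqrt{\tfrac{\log(pL_N)}{N}}\ \text{ for all }0\le\ell<L_N\Big)\ \ge\ 1-c_1e^{-c_2\log(pL_N)},$$ where $\displaystyle\mathcal F_N=\max_{\ell<L_N}c_0\,C_{\ell;Z}\Big(1+\frac{1+\mu_{\max;\ell}}{\mu_{\min;\ell}}\Big)$. -/

import Mathlib

open MeasureTheory ProbabilityTheory Filter Topology

noncomputable section

namespace SPHAR

/-- Euclidean three-space. -/
abbrev E3 : Type := EuclideanSpace ℝ (Fin 3)

/-- The unit sphere `𝕊²`. -/
abbrev S2 : Type := Metric.sphere (0 : E3) 1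

/-- The spherical Lebesgue measure `dx` on `𝕊²` (total mass `4π`). -/
def surf : Measure S2 := (volume : Measure E3).toSphere

/-- Action of a linear isometry of `ℝ³` on `𝕊²`. -/
def rotate (R : E3 ≃ₗᵢ[ℝ] E3) (x : S2) : S2 := ⟨R (x : E3), by simp⟩

/-- Elements of `SO(3)`: linear isometries of `ℝ³` of determinant one. -/
def IsRotation (R : E3 ≃ₗᵢ[ℝ] E3) : Prop :=
  LinearMap.det (R.toLinearEquiv : E3 →ₗ[ℝ] E3) = 1

/-! ### Real spherical harmonics -/

/-- `f` is (the restriction to `𝕊²` of) a homogeneous harmonic polynomial of degree `ℓ`, that is,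
an element of the space `𝓗_ℓ` of spherical harmonics of degree `ℓ`. -/
def IsSphericalHarmonic (ℓ : ℕ) (f : S2 → ℝ) : Prop :=
  ∃ P : MvPolynomial (Fin 3) ℝ, P.IsHomogeneous ℓ ∧
    ∑ i : Fin 3, MvPolynomial.pderiv i (MvPolynomial.pderiv i P) = 0 ∧
    ∀ x : S2, f x = MvPolynomial.eval (fun i => (x : E3) i) P

/-- `Y` is an orthonormal basis of real spherical harmonics: for each `ℓ` the `2ℓ+1` functions
`Y ℓ m` belong to `𝓗_ℓ` (a space of dimension `2ℓ+1`), and the whole family is orthonormal in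
`L²(𝕊²)`. The azimuth number `-ℓ, …, ℓ` is shifted to `0, …, 2ℓ`. -/
structure IsHarmonicBasis (Y : (ℓ : ℕ) → Fin (2 * ℓ + 1) → S2 → ℝ) : Prop where
  harmonic : ∀ ℓ m, IsSphericalHarmonic ℓ (Y ℓ m)
  normalized : ∀ ℓ m, ∫ x, Y ℓ m x * Y ℓ m x ∂surf = 1
  orthogonal : ∀ ℓ m ℓ' m', (⟨ℓ, m⟩ : Σ ℓ : ℕ, Fin (2 * ℓ + 1)) ≠ ⟨ℓ', m'⟩ →
    ∫ x, Y ℓ m x * Y ℓ' m' x ∂surf = 0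

/-- The reproducing kernel `∑ₘ Y_{ℓ,m}(x) Y_{ℓ,m}(y)` of `𝓗_ℓ`; by the addition formula it is
`(2ℓ+1)/(4π) P_ℓ(⟨x,y⟩)` with `P_ℓ` the Legendre polynomial. -/
def zonalKernel (Y : (ℓ : ℕ) → Fin (2 * ℓ + 1) → S2 → ℝ) (ℓ : ℕ) (x y : S2) : ℝ :=
  ∑ m : Fin (2 * ℓ + 1), Y ℓ m x * Y ℓ m y

/-! ### Sphere-cross-time random fields -/

section Fields

variable {Ω : Type*} [MeasurableSpace Ω]

/-- Harmonic coefficients `a_{ℓ,m}(t) = ∫ X(x,t) Y_{ℓ,m}(x) dx`. -/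
def coeff (Y : (ℓ : ℕ) → Fin (2 * ℓ + 1) → S2 → ℝ) (X : S2 → ℤ → Ω → ℝ)
    (ℓ : ℕ) (m : Fin (2 * ℓ + 1)) (t : ℤ) (ω : Ω) : ℝ :=
  ∫ x, X x t ω * Y ℓ m x ∂surf

/-- A measurable, Gaussian, centered, mean-square continuous real random field on `𝕊² × ℤ` that is
isotropic in space and stationary in time:
`T(R ·, · + τ)` and `T(·, ·)` have the same law for every `R ∈ SO(3)`, `τ ∈ ℤ`. -/
structure IsIsotropicStationaryField (μ : Measure Ω) (T : S2 → ℤ → Ω → ℝ) : Prop where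
  measurable : ∀ t, Measurable (fun q : S2 × Ω => T q.1 t q.2)
  gaussian : IsGaussianProcess (fun q : S2 × ℤ => T q.1 q.2) μ
  centered : ∀ x t, ∫ ω, T x t ω ∂μ = 0
  meanSquareContinuous : ∀ x t,
    Tendsto (fun y => ∫ ω, (T y t ω - T x t ω) ^ 2 ∂μ) (𝓝 x) (𝓝 0)
  invariant : ∀ (R : E3 ≃ₗᵢ[ℝ] E3), IsRotation R → ∀ τ : ℤ,
    IdentDistrib (fun ω (q : S2 × ℤ) => T (rotate R q.1) (q.2 + τ) ω)
      (fun ω (q : S2 × ℤ) => T q.1 q.2 ω) μ μ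

/-- The covariance `Γ_Z(x,y) = E[Z(x,t) Z(y,t)]`. -/
def cov (μ : Measure Ω) (Z : S2 → ℤ → Ω → ℝ) (t : ℤ) (x y : S2) : ℝ :=
  ∫ ω, Z x t ω * Z y t ω ∂μ

/-- Gaussian spherical white noise with angular power spectrum `C`: the fields `Z(·,t)`, `t ∈ ℤ`,
are independent and identically distributed, each is Gaussian, centered, isotropic, and
`Γ_Z(x,y) = ∑_ℓ C_ℓ ∑ₘ Y_{ℓ,m}(x) Y_{ℓ,m}(y)` with `∑_ℓ (2ℓ+1)/(4π) C_ℓ < ∞`. -/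
structure IsSphericalWhiteNoise (Y : (ℓ : ℕ) → Fin (2 * ℓ + 1) → S2 → ℝ) (C : ℕ → ℝ)
    (μ : Measure Ω) (Z : S2 → ℤ → Ω → ℝ) : Prop where
  measurable : ∀ t, Measurable (fun q : S2 × Ω => Z q.1 t q.2)
  indep : iIndepFun (fun (t : ℤ) (ω : Ω) (x : S2) => Z x t ω) μ
  identDistrib : ∀ s t : ℤ,
    IdentDistrib (fun ω (x : S2) => Z x s ω) (fun ω (x : S2) => Z x t ω) μ μ
  gaussian : ∀ t, IsGaussianProcess (fun x : S2 => Z x t) μ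
  centered : ∀ x t, ∫ ω, Z x t ω ∂μ = 0
  isotropic : ∀ (R : E3 ≃ₗᵢ[ℝ] E3), IsRotation R → ∀ t : ℤ,
    IdentDistrib (fun ω (x : S2) => Z (rotate R x) t ω) (fun ω (x : S2) => Z x t ω) μ μ
  summable : Summable (fun ℓ : ℕ => (2 * (ℓ : ℝ) + 1) / (4 * Real.pi) * C ℓ)
  spectrum : ∀ t x y, HasSum (fun ℓ : ℕ => C ℓ * zonalKernel Y ℓ x y) (cov μ Z t x y)

/-- The identifiability condition: `∬ Γ_Z(x,y) f(x) f(y) dx dy > 0` for every nonzero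
`f ∈ L²(𝕊²)`. -/
def Identifiable (μ : Measure Ω) (Z : S2 → ℤ → Ω → ℝ) : Prop :=
  ∀ (t : ℤ) (f : S2 → ℝ), MemLp f 2 surf → ¬ (f =ᵐ[surf] 0) →
    0 < ∫ q : S2 × S2, cov μ Z t q.1 q.2 * f q.1 * f q.2 ∂(surf.prod surf)

/-! ### Autoregressive kernels and the functional autoregression -/

/-- The integral operator `(Φ f)(x) = ∫ k(⟨x,y⟩) f(y) dy` of an isotropic kernel. -/
def kernelOp (k : ℝ → ℝ) (f : S2 → ℝ) (x : S2) : ℝ :=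
  ∫ y, k (inner ℝ (x : E3) (y : E3)) * f y ∂surf

/-- The kernel `k` is continuous on `[-1,1]` and `lam ℓ` is the eigenvalue of its
operator on the spherical harmonics of degree `ℓ`. -/
structure HasKernelEigenvalues (Y : (ℓ : ℕ) → Fin (2 * ℓ + 1) → S2 → ℝ) (k : ℝ → ℝ)
    (lam : ℕ → ℝ) : Prop where
  continuousOn : ContinuousOn k (Set.Icc (-1) 1)
  eigen : ∀ ℓ m x, kernelOp k (Y ℓ m) x = lam ℓ * Y ℓ m x

/-- The spherical autoregressive equation of order `p`,
`T(x,t) = ∑_{j=1}^p (Φ_j T(·,t-j))(x) + Z(x,t)`; the lag `j` corresponds to the index `j-1` in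
`Fin p`. -/
def SolvesAR {p : ℕ} (μ : Measure Ω) (k : Fin p → ℝ → ℝ) (T Z : S2 → ℤ → Ω → ℝ) : Prop :=
  ∀ t : ℤ, ∀ᵐ ω ∂μ, ∀ᵐ x ∂surf,
    T x t ω = (∑ j : Fin p, kernelOp (k j) (fun y => T y (t - ((j : ℤ) + 1)) ω) x) + Z x t ω

end Fields

/-- The associated polynomial `1 - φ₁ z - ⋯ - φ_p z^p`. -/
def arPoly {p : ℕ} (φ : Fin p → ℝ) (z : ℂ) : ℂ :=
  1 - ∑ j : Fin p, (φ j : ℂ) * z ^ ((j : ℕ) + 1)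

/-- The stationarity condition: no associated polynomial vanishes on the closed unit disk. -/
def Stationary {p : ℕ} (φ : ℕ → Fin p → ℝ) : Prop :=
  ∀ (ℓ : ℕ) (z : ℂ), ‖z‖ ≤ 1 → arPoly (φ ℓ) z ≠ 0

/-- `μ_min = min_{|z|=1} |φ(z)|²` -/
def muMin {p : ℕ} (φ : Fin p → ℝ) : ℝ := sInf ((fun z : ℂ => ‖arPoly φ z‖ ^ 2) '' {z | ‖z‖ = 1})

/-- `μ_max = max_{|z|=1} |φ(z)|²` -/
def muMax {p : ℕ} (φ : Fin p → ℝ) : ℝ := sSup ((fun z : ℂ => ‖arPoly φ z‖ ^ 2) '' {z | ‖z‖ = 1})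

/-- `𝓕_N = max_{ℓ < L} c₀ C_ℓ (1 + (1 + μ_{max;ℓ}) / μ_{min;ℓ})` -/
def FN {p : ℕ} (c₀ : ℝ) (φ : ℕ → Fin p → ℝ) (C : ℕ → ℝ) (L : ℕ) : ℝ :=
  ⨆ ℓ : Fin L, c₀ * (C ℓ * (1 + (1 + muMax (φ ℓ)) / muMin (φ ℓ)))

/-! ### Sample quantities built from observations at times `1, …, n`, `n = N + p` -/

section Sample

variable {Ω : Type*}

/-- The vector of responses `(a_{ℓ,m}(n), …, a_{ℓ,m}(p+1))_m`; the entry `(m, i)` is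
`a_{ℓ,m}(n - i)`. -/
def respVec (Y : (ℓ : ℕ) → Fin (2 * ℓ + 1) → S2 → ℝ) (T : S2 → ℤ → Ω → ℝ) (p N ℓ : ℕ) (ω : Ω) :
    Fin (2 * ℓ + 1) × Fin N → ℝ :=
  fun r => coeff Y T ℓ r.1 (((N : ℤ) + p) - (r.2 : ℕ)) ω

/-- The design matrix, whose column of lag `h = 1, …, p` has entries `a_{ℓ,m}(n - i - h)`. -/
def design (Y : (ℓ : ℕ) → Fin (2 * ℓ + 1) → S2 → ℝ) (T : S2 → ℤ → Ω → ℝ) (p N ℓ : ℕ) (ω : Ω) :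
    Matrix (Fin (2 * ℓ + 1) × Fin N) (Fin p) ℝ :=
  Matrix.of fun r h => coeff Y T ℓ r.1 (((N : ℤ) + p) - (r.2 : ℕ) - ((h : ℤ) + 1)) ω

/-- `γ̂_{ℓ,N} = X' Y / (N(2ℓ+1))` -/
def gammaHat (Y : (ℓ : ℕ) → Fin (2 * ℓ + 1) → S2 → ℝ) (T : S2 → ℤ → Ω → ℝ) (p N ℓ : ℕ) (ω : Ω) :
    Fin p → ℝ :=
  ((N : ℝ) * (2 * (ℓ : ℝ) + 1))⁻¹ •
    ((design Y T p N ℓ ω).transpose.mulVec (respVec Y T p N ℓ ω))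

/-- `Γ̂_{ℓ,N} = X' X / (N(2ℓ+1))` -/
def GammaHat (Y : (ℓ : ℕ) → Fin (2 * ℓ + 1) → S2 → ℝ) (T : S2 → ℤ → Ω → ℝ) (p N ℓ : ℕ) (ω : Ω) :
    Matrix (Fin p) (Fin p) ℝ :=
  ((N : ℝ) * (2 * (ℓ : ℝ) + 1))⁻¹ • ((design Y T p N ℓ ω).transpose * design Y T p N ℓ ω)

end Sample

end SPHAR

end

/-!
The vector `γ̂ - Γ̂ φ` consists of normalized scores `∑ a_{ℓ,m}(t - h) ε_{ℓ,m}(t)`, where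
`a_{ℓ,m}` are the harmonic coefficients of the field and `ε_{ℓ,m}` those of the noise: integrating
the field equation against `Y_{ℓ,m}` and using the symmetry of the kernel operators turns it into
the scalar autoregression `a(t) = ∑ φ_j a(t - j) + ε(t)` (`SolvesAR.coeff_eq`). So it suffices to
prove an exponential tail bound for a single score and to take the union bound over the `L` degrees
and the `p` lags.

* *Gaussianity.* All `ε_{ℓ,m}(t)` lie in the closed span of the noise in `L²`
  (`toLp_integral_mul_mem_closure_span`), which consists of centered Gaussian variables because
  limits of Gaussian variables are Gaussian (`IsGaussianSubspace.topologicalClosure`). The spectral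
  form of the covariance makes them uncorrelated with variance `C_ℓ`
  (`IsSphericalWhiteNoise.integral_coeff_mul_coeff`).
* *Causality and the spectral bound.* As the associated polynomial `φ(z)` has no zero in the closed
  unit disk, there are polynomials `P` for which `P φ - 1` is small in the `ℓ¹` norm of the
  coefficients (`exists_coeffNorm_mul_sub_one_lt`). Applying `P` to the backward shift gives
  `a ≈ P(B) ε` for the bounded solution `a`. Hence `a(t)` lies in the closed span of the innovations
  up to time `t` (`mem_closure_span_of_autoregression`) and, as `|P| ≈ 1 / |φ| ≤ 1 / √μ_min` on the
  unit circle, Parseval's identity bounds the covariance matrix of any sample of `a` by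
  `C_ℓ / μ_min` (`norm_sq_aeval_backShift_le_of_autoregression`).
* *Concentration.* The score is a martingale transform `S = ∑ ⟨X_r, E_r⟩` with `E_r` independent of
  the past. Its exponential martingale has expectation one
  (`IsGaussianSubspace.lintegral_exp_martingale`), and `∑ |X_r|²` has a small exponential moment by
  the spectral bound (`IsGaussianSubspace.lintegral_exp_sum_sq_le`); together these yield
  `E exp (t S) ≤ exp (2 t² (C_ℓ² / μ_min) n)` for `n` summands and small `t`
  (`IsGaussianSubspace.lintegral_exp_sum_mul_le`). Chernoff's inequality gives probability at most
  `2 (p L)⁻³` for each lag and degree, since the deviation constant dominates `C_ℓ / √μ_min`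
  (`mul_div_sqrt_le_FN`).
-/

namespace SPHAR

/-! ### Gaussian subspaces of `L²` -/

section GaussianSubspace

variable {Ω : Type*} [MeasurableSpace Ω] {μ : Measure Ω}

/-- A subspace of `L²(μ)` all of whose elements are centered Gaussian variables. As the subspace is
stable under scaling, it is enough to prescribe the characteristic function at `1`. -/
def IsGaussianSubspace (G : Submodule ℝ (Lp ℝ 2 μ)) : Prop :=
  ∀ f ∈ G, ∫ ω, Complex.exp ((f ω : ℂ) * Complex.I) ∂μ = Complex.exp ((-(‖f‖ ^ 2 / 2) : ℝ) : ℂ)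

lemma norm_exp_mul_I_sub_le (x y : ℝ) :
    ‖Complex.exp ((x : ℂ) * Complex.I) - Complex.exp ((y : ℂ) * Complex.I)‖ ≤ ‖x - y‖ := by
  have h : Complex.exp ((x : ℂ) * Complex.I) - Complex.exp ((y : ℂ) * Complex.I)
      = Complex.exp ((y : ℂ) * Complex.I) * (Complex.exp (Complex.I * ((x - y : ℝ) : ℂ)) - 1) := by
    rw [mul_sub, ← Complex.exp_add]
    push_cast
    ring_nf
  rw [h, norm_mul, Complex.norm_exp_ofReal_mul_I, one_mul]
  exact Real.norm_exp_I_mul_ofReal_sub_one_le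

lemma integrable_exp_mul_I [IsFiniteMeasure μ] {f : Ω → ℝ} (hf : AEStronglyMeasurable f μ) :
    Integrable (fun ω => Complex.exp ((f ω : ℂ) * Complex.I)) μ := by
  refine Integrable.of_bound (C := 1) ?_ (ae_of_all _ fun ω => ?_)
  · exact (by fun_prop : Continuous fun x : ℝ => Complex.exp ((x : ℂ) * Complex.I))
      |>.comp_aestronglyMeasurable hf
  · rw [Complex.norm_exp_ofReal_mul_I]

lemma integral_norm_sub_le_norm_Lp_two [IsProbabilityMeasure μ] (f g : Lp ℝ 2 μ) :
    ∫ ω, ‖f ω - g ω‖ ∂μ ≤ ‖f - g‖ := by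
  have h1 : ∫ ω, ‖f ω - g ω‖ ∂μ = ∫ ω, ‖(f - g) ω‖ ∂μ :=
    integral_congr_ae (by filter_upwards [Lp.coeFn_sub f g] with ω h; rw [h]; rfl)
  have hm : MemLp (f - g : Lp ℝ 2 μ) 2 μ := Lp.memLp _
  have h2 : eLpNorm (f - g : Lp ℝ 2 μ) 1 μ ≤ eLpNorm (f - g : Lp ℝ 2 μ) 2 μ :=
    eLpNorm_le_eLpNorm_of_exponent_le (by norm_num) hm.1
  rw [h1, Lp.norm_def, integral_norm_eq_lintegral_enorm hm.1, ← eLpNorm_one_eq_lintegral_enorm]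
  exact ENNReal.toReal_mono hm.2.ne h2

lemma continuous_integral_exp_mul_I [IsProbabilityMeasure μ] :
    Continuous fun f : Lp ℝ 2 μ => ∫ ω, Complex.exp ((f ω : ℂ) * Complex.I) ∂μ := by
  refine LipschitzWith.continuous (K := 1) (LipschitzWith.of_dist_le_mul fun f g => ?_)
  rw [dist_eq_norm, dist_eq_norm, NNReal.coe_one, one_mul,
    ← integral_sub (integrable_exp_mul_I (Lp.aestronglyMeasurable f))
      (integrable_exp_mul_I (Lp.aestronglyMeasurable g))]
  refine (norm_integral_le_integral_norm _).trans
    (le_trans (integral_mono_of_nonneg (ae_of_all _ fun _ => norm_nonneg _) ?_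
      (ae_of_all _ fun ω => norm_exp_mul_I_sub_le _ _)) (integral_norm_sub_le_norm_Lp_two f g))
  exact ((((Lp.memLp f).sub (Lp.memLp g)).integrable (by norm_num)).norm :)

/-- A limit in `L²` of centered Gaussian variables is a centered Gaussian variable. -/
lemma IsGaussianSubspace.topologicalClosure [IsProbabilityMeasure μ] {G : Submodule ℝ (Lp ℝ 2 μ)}
    (hG : IsGaussianSubspace G) : IsGaussianSubspace G.topologicalClosure := by
  intro f hf
  have hc : IsClosed {f : Lp ℝ 2 μ | ∫ ω, Complex.exp ((f ω : ℂ) * Complex.I) ∂μ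
      = Complex.exp ((-(‖f‖ ^ 2 / 2) : ℝ) : ℂ)} :=
    isClosed_eq continuous_integral_exp_mul_I (by fun_prop)
  exact closure_minimal (s := (G : Set (Lp ℝ 2 μ))) (fun g hg => hG g hg) hc hf

lemma IsGaussianSubspace.map_eq [IsProbabilityMeasure μ] {G : Submodule ℝ (Lp ℝ 2 μ)}
    (hG : IsGaussianSubspace G) {f : Lp ℝ 2 μ} (hf : f ∈ G) :
    μ.map f = gaussianReal 0 (‖f‖₊ ^ 2) := by
  have hm : AEMeasurable f μ := (Lp.aestronglyMeasurable f).aemeasurable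
  have : IsProbabilityMeasure (μ.map f) := Measure.isProbabilityMeasure_map hm
  refine Measure.ext_of_charFun (funext fun t => ?_)
  rw [charFun_gaussianReal, charFun_apply_real, integral_map hm (by fun_prop)]
  have h := hG (t • f) (G.smul_mem t hf)
  rw [norm_smul] at h
  have h2 : ∫ ω, Complex.exp (((t • f : Lp ℝ 2 μ) ω : ℂ) * Complex.I) ∂μ
      = ∫ ω, Complex.exp ((t : ℂ) * (f ω : ℂ) * Complex.I) ∂μ :=
    integral_congr_ae (by filter_upwards [Lp.coeFn_smul t f] with ω h; simp [h])
  rw [← h2, h, mul_pow, Real.norm_eq_abs, sq_abs]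
  congr 1
  push_cast
  simp
  ring

lemma IsGaussianSubspace.integral_eq_zero [IsProbabilityMeasure μ] {G : Submodule ℝ (Lp ℝ 2 μ)}
    (hG : IsGaussianSubspace G) {f : Lp ℝ 2 μ} (hf : f ∈ G) : ∫ ω, f ω ∂μ = 0 := by
  have hm : AEMeasurable f μ := (Lp.aestronglyMeasurable f).aemeasurable
  have h := integral_map hm (f := fun x : ℝ => x) (by fun_prop)
  rw [hG.map_eq hf, integral_id_gaussianReal] at h
  exact h.symm

lemma IsGaussianSubspace.lintegral_exp [IsProbabilityMeasure μ] {G : Submodule ℝ (Lp ℝ 2 μ)}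
    (hG : IsGaussianSubspace G) {f : Lp ℝ 2 μ} (hf : f ∈ G) :
    ∫⁻ ω, ENNReal.ofReal (Real.exp (f ω)) ∂μ = ENNReal.ofReal (Real.exp (‖f‖ ^ 2 / 2)) := by
  have hm : AEMeasurable f μ := (Lp.aestronglyMeasurable f).aemeasurable
  have h := mgf_gaussianReal (hG.map_eq hf) 1
  simp only [mgf, one_mul, zero_add, one_pow, mul_one] at h
  rw [← ofReal_integral_eq_lintegral_ofReal, h]
  · rfl
  -- a non-integrable exponential would have the junk integral `0`, but the value is positive
  · by_contra hc
    rw [integral_undef hc] at h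
    exact (Real.exp_pos _).ne h
  · exact ae_of_all _ fun _ => (Real.exp_pos _).le

/-- The span of a centered Gaussian process is a Gaussian subspace. -/
lemma isGaussianSubspace_span [IsProbabilityMeasure μ] {S : Type*} {X : S → Ω → ℝ}
    (hX : IsGaussianProcess X μ) (h0 : ∀ s, ∫ ω, X s ω ∂μ = 0) (h2 : ∀ s, MemLp (X s) 2 μ) :
    IsGaussianSubspace (Submodule.span ℝ (Set.range fun s => (h2 s).toLp)) := by
  intro f hf
  obtain ⟨c, rfl⟩ := Finsupp.mem_span_range_iff_exists_finsupp.mp hf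
  set f : Lp ℝ 2 μ := c.sum fun i a => a • (h2 i).toLp with hfdef
  have hfe : f =ᵐ[μ] fun ω => ∑ s ∈ c.support, c s • X s ω := by
    have h1 : (f : Ω → ℝ) =ᵐ[μ] ∑ s ∈ c.support, ⇑(c s • (h2 s).toLp) := by
      rw [hfdef, Finsupp.sum]; exact Lp.coeFn_finsetSum _ _
    have h3 : ∀ᵐ ω ∂μ, ∀ s ∈ c.support, (c s • (h2 s).toLp : Lp ℝ 2 μ) ω = c s • X s ω := by
      refine (ae_ball_iff c.support.countable_toSet).2 fun s _ => ?_
      filter_upwards [Lp.coeFn_smul (c s) (h2 s).toLp, (h2 s).coeFn_toLp] with ω e1 e2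
      rw [e1, Pi.smul_apply, e2]
    filter_upwards [h1, h3] with ω e1 e2
    rw [e1, Finset.sum_apply]
    exact Finset.sum_congr rfl e2
  have hg : HasGaussianLaw f μ :=
    ((hX.smul c).hasGaussianLaw_fun_sum (I := c.support)).congr hfe.symm
  have hmean : ∫ ω, f ω ∂μ = 0 := by
    rw [integral_congr_ae hfe, integral_finsetSum]
    · exact Finset.sum_eq_zero fun s _ => by rw [integral_smul, h0, smul_zero]
    · exact fun s _ => ((h2 s).integrable (by norm_num)).const_mul _
  have hvar : Var[f; μ] = ‖f‖ ^ 2 := by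
    rw [variance_of_integral_eq_zero (Lp.aestronglyMeasurable f).aemeasurable hmean,
      ← real_inner_self_eq_norm_sq, L2.inner_def]
    exact integral_congr_ae (ae_of_all _ fun ω => by simp [sq])
  have := hg.charFun_map_eq 1
  rw [charFun_apply_real, integral_map hg.aemeasurable (by fun_prop)] at this
  have hinner : (fun ω => inner ℝ (1 : ℝ) (f ω)) = f := by ext ω; simp
  rw [hinner] at this
  simp only [Complex.ofReal_one, one_mul] at this
  rw [this, show integral μ f = 0 from hmean, hvar]
  congr 1
  push_cast
  ring

/-- Representatives of elements of a Gaussian subspace are jointly Gaussian. -/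
lemma IsGaussianSubspace.isGaussianProcess [IsProbabilityMeasure μ] {G : Submodule ℝ (Lp ℝ 2 μ)}
    (hG : IsGaussianSubspace G) {S : Type*} {F : S → Lp ℝ 2 μ} (hF : ∀ s, F s ∈ G) :
    IsGaussianProcess (fun s => (F s : Ω → ℝ)) μ where
  hasGaussianLaw I := by
    have hm : AEMeasurable (fun ω => I.restrict fun s => F s ω) μ :=
      aemeasurable_pi_lambda _ fun s => (Lp.aestronglyMeasurable (F s)).aemeasurable
    refine ⟨isGaussian_of_map_eq_gaussianReal fun L => ?_⟩
    classical
    set g : Lp ℝ 2 μ := ∑ s : I, L (Pi.single s 1) • F s with hg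
    have hgG : g ∈ G := G.sum_mem fun s _ => G.smul_mem _ (hF _)
    refine ⟨0, ‖g‖₊ ^ 2, ?_⟩
    rw [AEMeasurable.map_map_of_aemeasurable (by fun_prop) hm, ← hG.map_eq hgG]
    refine Measure.map_congr ?_
    have h1 : (g : Ω → ℝ) =ᵐ[μ] ∑ s : I, ⇑(L (Pi.single s 1) • F s) := by
      rw [hg]; exact Lp.coeFn_finsetSum _ _
    have h3 : ∀ᵐ ω ∂μ, ∀ s : I,
        (L (Pi.single s 1) • F s : Lp ℝ 2 μ) ω = L (Pi.single s 1) • F s ω :=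
      ae_all_iff.2 fun s => Lp.coeFn_smul _ _
    filter_upwards [h1, h3] with ω e1 e2
    rw [e1, Finset.sum_apply, Function.comp_apply]
    conv_lhs => rw [← ContinuousLinearMap.coe_coe, LinearMap.pi_apply_eq_sum_univ]
    refine Finset.sum_congr rfl fun s _ => ?_
    rw [e2]
    simp only [smul_eq_mul, Finset.restrict, ContinuousLinearMap.coe_coe]
    rw [mul_comm]
    congr 2
    ext i
    simp [Pi.single_apply, eq_comm]

lemma IsGaussianSubspace.covariance_eq_inner [IsProbabilityMeasure μ]
    {G : Submodule ℝ (Lp ℝ 2 μ)} (hG : IsGaussianSubspace G) {f : Lp ℝ 2 μ} (hf : f ∈ G)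
    (g : Lp ℝ 2 μ) : cov[f, g; μ] = inner ℝ f g := by
  rw [covariance_eq_sub (Lp.memLp f) (Lp.memLp g), hG.integral_eq_zero hf, zero_mul, sub_zero,
    L2.inner_def]
  exact integral_congr_ae (ae_of_all _ fun ω => by simp [mul_comm])

/-- Two families in a Gaussian subspace which are orthogonal to each other are independent. -/
lemma IsGaussianSubspace.indepFun [IsProbabilityMeasure μ]
    {G : Submodule ℝ (Lp ℝ 2 μ)} (hG : IsGaussianSubspace G) {S T : Type*} {F : S → Lp ℝ 2 μ}
    {F' : T → Lp ℝ 2 μ} (hF : ∀ s, F s ∈ G) (hF' : ∀ t, F' t ∈ G)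
    (h : ∀ s t, inner ℝ (F s) (F' t) = 0) :
    IndepFun (fun ω s => F s ω) (fun ω t => F' t ω) μ := by
  refine IsGaussianProcess.indepFun_of_covariance_eq_zero
    (X := fun s => (F s : Ω → ℝ)) (Y := fun t => (F' t : Ω → ℝ)) ?_ ?_ ?_ ?_
  · have := hG.isGaussianProcess (F := Sum.elim F F') (by rintro (s | t) <;> simp [hF, hF'])
    convert this using 1
    ext (s | t) <;> rfl
  · exact fun s => (Lp.aestronglyMeasurable _).aemeasurable
  · exact fun s => (Lp.aestronglyMeasurable _).aemeasurable
  · exact fun s t => by rw [hG.covariance_eq_inner (hF s), h]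

/-- Independent Gaussian processes are jointly Gaussian. -/
lemma isGaussianProcess_prod_of_iIndepFun {S T : Type*} {X : T → S → Ω → ℝ}
    (hX : ∀ t, IsGaussianProcess (X t) μ) (hi : iIndepFun (fun t ω s => X t s ω) μ) :
    IsGaussianProcess (fun q : S × T => X q.2 q.1) μ where
  hasGaussianLaw I := by
    classical
    let J := I.image Prod.fst
    let K := I.image Prod.snd
    have h1 : iIndepFun (fun (t : K) ω => J.restrict (fun s => X t s ω)) μ :=
      (hi.precomp (g := fun t : K => (t : T)) Subtype.val_injective).comp
        (fun _ f => J.restrict f) (fun _ => by fun_prop)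
    have h2 := iIndepFun.hasGaussianLaw (fun t : K => (hX t).hasGaussianLaw J) h1
    let L : (K → J → ℝ) →L[ℝ] (I → ℝ) :=
      { toFun x q := x ⟨q.1.2, Finset.mem_image_of_mem _ q.2⟩
          ⟨q.1.1, Finset.mem_image_of_mem _ q.2⟩
        map_add' x y := by ext; simp
        map_smul' c x := by ext; simp }
    exact h2.map L

end GaussianSubspace

/-! ### Approximate inverses of polynomials without zeros in the closed unit disk -/

section CoeffNorm

open Polynomial

variable {𝕜 : Type*} [RCLike 𝕜]

/-- The sum of the absolute values of the coefficients of a polynomial. -/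
noncomputable def coeffNorm (q : 𝕜[X]) : ℝ := q.sum fun _ c => ‖c‖

lemma coeffNorm_eq_sum_range (q : 𝕜[X]) {n : ℕ} (h : q.natDegree < n) :
    coeffNorm q = ∑ i ∈ Finset.range n, ‖q.coeff i‖ :=
  q.sum_over_range' (fun _ => norm_zero) n h

lemma coeffNorm_nonneg (q : 𝕜[X]) : 0 ≤ coeffNorm q := by
  rw [coeffNorm_eq_sum_range q (Nat.lt_succ_self _)]; positivity

lemma coeffNorm_add_le (p q : 𝕜[X]) : coeffNorm (p + q) ≤ coeffNorm p + coeffNorm q := by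
  set n := max p.natDegree q.natDegree + 1 with hn
  have h3 : (p + q).natDegree < n := (natDegree_add_le p q).trans_lt (by omega)
  rw [coeffNorm_eq_sum_range p (n := n) (by omega), coeffNorm_eq_sum_range q (n := n) (by omega),
    coeffNorm_eq_sum_range _ h3, ← Finset.sum_add_distrib]
  exact Finset.sum_le_sum fun i _ => by rw [coeff_add]; exact norm_add_le _ _

lemma coeffNorm_C_mul_le (c : 𝕜) (q : 𝕜[X]) : coeffNorm (C c * q) ≤ ‖c‖ * coeffNorm q := by
  have h : (C c * q).natDegree < q.natDegree + 1 :=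
    (natDegree_C_mul_le c q).trans_lt (Nat.lt_succ_self _)
  rw [coeffNorm_eq_sum_range _ h, coeffNorm_eq_sum_range q (Nat.lt_succ_self _), Finset.mul_sum]
  exact Finset.sum_le_sum fun i _ => by rw [coeff_C_mul, norm_mul]

lemma coeffNorm_X_mul_le (q : 𝕜[X]) : coeffNorm (X * q) ≤ coeffNorm q := by
  have h : (X * q).natDegree < q.natDegree + 1 + 1 :=
    natDegree_mul_le.trans_lt (by rw [natDegree_X]; omega)
  rw [coeffNorm_eq_sum_range _ h, coeffNorm_eq_sum_range q (Nat.lt_succ_self _),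
    Finset.sum_range_succ']
  simp [coeff_X_mul]

lemma coeffNorm_X_pow_mul_le (n : ℕ) (q : 𝕜[X]) : coeffNorm (X ^ n * q) ≤ coeffNorm q := by
  induction n with
  | zero => simp
  | succ n ih => rw [pow_succ', mul_assoc]; exact (coeffNorm_X_mul_le _).trans ih

/-- A form of Wiener's lemma: the inverse of a polynomial without zeros in the closed unit disk is
approximated by polynomials in the `ℓ¹` norm of the coefficients. One root at a time, the factor
`(1 - ρ z)⁻¹` is replaced by a partial sum of its geometric series. -/
lemma exists_coeffNorm_mul_sub_one_lt_complex (n : ℕ) : ∀ (q : ℂ[X]), q.natDegree = n →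
    (∀ z : ℂ, ‖z‖ ≤ 1 → q.eval z ≠ 0) → ∀ ε > 0, ∃ P : ℂ[X], coeffNorm (P * q - 1) < ε := by
  induction n using Nat.strong_induction_on with
  | _ n ih =>
  intro q hq h ε hε
  by_cases hd : n = 0
  · obtain ⟨c, rfl⟩ := natDegree_eq_zero.1 (hq.trans hd)
    have hc : c ≠ 0 := by simpa using h 0 (by simp)
    refine ⟨C c⁻¹, ?_⟩
    rw [← C_mul, inv_mul_cancel₀ hc]
    simpa [coeffNorm] using hε
  obtain ⟨r, hr⟩ := IsAlgClosed.exists_root q (by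
    intro h0; rw [← hq, natDegree_eq_of_degree_eq_some h0] at hd; exact hd rfl)
  have hr1 : 1 < ‖r‖ := by
    by_contra hc
    exact h r (not_lt.1 hc) hr
  have hr0 : r ≠ 0 := by rintro rfl; norm_num at hr1
  obtain ⟨q', rfl⟩ := dvd_iff_isRoot.2 hr
  have hq'0 : q' ≠ 0 := by
    rintro rfl
    exact h 0 (by simp) (by simp)
  have hdeg : (C (-r) * q').natDegree < n := by
    rw [natDegree_C_mul (neg_ne_zero.2 hr0), ← hq,
      natDegree_mul (X_sub_C_ne_zero r) hq'0, natDegree_X_sub_C]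
    omega
  have hε3 : 0 < min (ε / 3) 1 := by positivity
  obtain ⟨P, hP⟩ := ih _ hdeg (C (-r) * q') rfl (fun z hz h0 => h z hz (by
    rw [eval_mul] at h0 ⊢
    rw [eval_C] at h0
    rw [(mul_eq_zero.1 h0).resolve_left (neg_ne_zero.2 hr0), mul_zero])) _ hε3
  have hρ : ‖r⁻¹‖ < 1 := by rw [norm_inv]; exact inv_lt_one_of_one_lt₀ hr1
  obtain ⟨k, hk⟩ := exists_pow_lt_of_lt_one hε3 hρ
  refine ⟨P * ∑ i ∈ Finset.range k, (C r⁻¹ * X) ^ i, ?_⟩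
  have hgeom : (∑ i ∈ Finset.range k, (C r⁻¹ * X) ^ i) * (X - C r)
      = (1 - C (r⁻¹ ^ k) * X ^ k) * C (-r) := by
    have h1 : (X - C r : ℂ[X]) = (1 - C r⁻¹ * X) * C (-r) := by
      have : C r⁻¹ * C r = (1 : ℂ[X]) := by rw [← C_mul, inv_mul_cancel₀ hr0, C_1]
      rw [C_neg]
      linear_combination (-X) * this
    rw [h1, ← mul_assoc, geom_sum_mul_neg, mul_pow, C_pow]
  set D := P * (C (-r) * q') - 1 with hD
  have hexp : P * (∑ i ∈ Finset.range k, (C r⁻¹ * X) ^ i) * ((X - C r) * q') - 1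
      = D + (C (-r⁻¹ ^ k) * (X ^ k * D) + C (-r⁻¹ ^ k) * (X ^ k * 1)) := by
    have : P * (∑ i ∈ Finset.range k, (C r⁻¹ * X) ^ i) * ((X - C r) * q')
        = P * ((∑ i ∈ Finset.range k, (C r⁻¹ * X) ^ i) * (X - C r)) * q' := by ring
    rw [this, hgeom, hD]
    simp only [C_neg]
    ring
  rw [hexp]
  have h1 := coeffNorm_add_le D (C (-r⁻¹ ^ k) * (X ^ k * D) + C (-r⁻¹ ^ k) * (X ^ k * 1))
  have h2 := coeffNorm_add_le (C (-r⁻¹ ^ k) * (X ^ k * D)) (C (-r⁻¹ ^ k) * (X ^ k * 1))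
  have h3 : ‖-r⁻¹ ^ k‖ ≤ min (ε / 3) 1 := by rw [norm_neg, norm_pow]; exact hk.le
  have h4 := coeffNorm_C_mul_le (-r⁻¹ ^ k) (X ^ k * D)
  have h5 := coeffNorm_C_mul_le (-r⁻¹ ^ k) (X ^ k * (1 : ℂ[X]))
  have h6 := coeffNorm_X_pow_mul_le k D
  have h7 := coeffNorm_X_pow_mul_le k (1 : ℂ[X])
  have h8 : coeffNorm (1 : ℂ[X]) = 1 := by
    rw [coeffNorm_eq_sum_range (1 : ℂ[X]) (n := 1) (by simp)]; simp
  have h9 := min_le_left (ε / 3) 1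
  have h10 := min_le_right (ε / 3) 1
  have h11 : ‖-r⁻¹ ^ k‖ * coeffNorm (X ^ k * D) ≤ 1 * coeffNorm D :=
    mul_le_mul (h3.trans h10) h6 (coeffNorm_nonneg _) zero_le_one
  have h12 : ‖-r⁻¹ ^ k‖ * coeffNorm (X ^ k * (1 : ℂ[X])) ≤ ε / 3 * 1 :=
    mul_le_mul (h3.trans h9) (h7.trans h8.le) (coeffNorm_nonneg _) (by positivity)
  linarith

/-- The polynomial whose coefficients are the real parts of those of `P`. -/
noncomputable def rePoly (P : ℂ[X]) : ℝ[X] :=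
  ∑ i ∈ Finset.range (P.natDegree + 1), monomial i (P.coeff i).re

lemma coeff_rePoly (P : ℂ[X]) (n : ℕ) : (rePoly P).coeff n = (P.coeff n).re := by
  simp only [rePoly, finsetSum_coeff, coeff_monomial, Finset.sum_ite_eq', Finset.mem_range]
  split_ifs with h
  · rfl
  · rw [coeff_eq_zero_of_natDegree_lt (by omega), Complex.zero_re]

lemma exists_coeffNorm_mul_sub_one_lt (q : ℝ[X]) (h : ∀ z : ℂ, ‖z‖ ≤ 1 → aeval z q ≠ 0)
    {ε : ℝ} (hε : 0 < ε) : ∃ P : ℝ[X], coeffNorm (P * q - 1) < ε := by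
  obtain ⟨P, hP⟩ := exists_coeffNorm_mul_sub_one_lt_complex _
    (q.map (algebraMap ℝ ℂ)) rfl (fun z hz => by
      rw [eval_map_algebraMap]; exact h z hz) ε hε
  refine ⟨rePoly P, lt_of_le_of_lt ?_ hP⟩
  set n := max (rePoly P * q - 1).natDegree (P * q.map (algebraMap ℝ ℂ) - 1).natDegree + 1
  rw [coeffNorm_eq_sum_range _ (n := n) (by omega), coeffNorm_eq_sum_range _ (n := n) (by omega)]
  refine Finset.sum_le_sum fun i _ => ?_
  have : (rePoly P * q - 1).coeff i = ((P * q.map (algebraMap ℝ ℂ) - 1).coeff i).re := by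
    simp only [coeff_sub, coeff_mul, Complex.sub_re, Complex.re_sum, coeff_rePoly, coeff_map,
      coeff_one, Complex.coe_algebraMap, Complex.re_mul_ofReal]
    congr 1
    split_ifs <;> simp
  rw [this]
  exact Complex.abs_re_le_norm _

end CoeffNorm

/-! ### Stationary solutions of autoregressions in a Hilbert space -/

section Autoregression

open Polynomial

variable {H : Type*} [NormedAddCommGroup H] [InnerProductSpace ℝ H]

/-- The backward shift `(B x)(t) = x(t - 1)` on sequences indexed by `ℤ`. -/
noncomputable def backShift : Module.End ℝ (ℤ → H) := LinearMap.funLeft ℝ H fun t => t - 1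

lemma backShift_pow_apply (n : ℕ) (x : ℤ → H) (t : ℤ) : (backShift ^ n) x t = x (t - n) := by
  induction n generalizing t with
  | zero => simp
  | succ n ih =>
    rw [pow_succ', Module.End.mul_apply, backShift, LinearMap.funLeft_apply, ← backShift, ih]
    congr 1
    push_cast
    ring

lemma aeval_backShift_apply (q : ℝ[X]) (x : ℤ → H) (t : ℤ) {n : ℕ} (hn : q.natDegree < n) :
    aeval backShift q x t = ∑ i ∈ Finset.range n, q.coeff i • x (t - i) := by
  rw [aeval_eq_sum_range' hn, LinearMap.sum_apply, Finset.sum_apply]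
  simp [backShift_pow_apply]

lemma norm_aeval_backShift_le (q : ℝ[X]) {x : ℤ → H} {K : ℝ} (hx : ∀ t, ‖x t‖ ≤ K) (t : ℤ) :
    ‖aeval backShift q x t‖ ≤ coeffNorm q * K := by
  rw [aeval_backShift_apply q x t (Nat.lt_succ_self _),
    coeffNorm_eq_sum_range q (Nat.lt_succ_self _), Finset.sum_mul]
  refine (norm_sum_le _ _).trans (Finset.sum_le_sum fun i _ => ?_)
  rw [norm_smul]
  exact mul_le_mul_of_nonneg_left (hx _) (norm_nonneg _)

lemma norm_sq_aeval_backShift {e : ℤ → H} {v : ℝ}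
    (he : ∀ s t, inner ℝ (e s) (e t) = if s = t then v else 0) (q : ℝ[X]) (t : ℤ) {n : ℕ}
    (hn : q.natDegree < n) :
    ‖aeval backShift q e t‖ ^ 2 = v * ∑ i ∈ Finset.range n, q.coeff i ^ 2 := by
  rw [← real_inner_self_eq_norm_sq, aeval_backShift_apply q e t hn, sum_inner, Finset.mul_sum]
  refine Finset.sum_congr rfl fun i hi => ?_
  rw [inner_sum, Finset.sum_eq_single_of_mem i hi]
  · rw [inner_smul_left, inner_smul_right, he, if_pos rfl]
    simp
    ring
  · intro j _ hj
    rw [inner_smul_left, inner_smul_right, he, if_neg (by omega)]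
    simp

/-- Parseval's identity: multiplication by a polynomial bounded by `M` on the unit circle enlarges
the `ℓ²` norm of the coefficients at most by the factor `M`. -/
lemma sum_sq_coeff_mul_le (U P : ℝ[X]) {M : ℝ} (hP : ∀ z : ℂ, ‖z‖ = 1 → ‖aeval z P‖ ^ 2 ≤ M)
    {m n : ℕ} (hm : (U * P).natDegree < m) (hn : U.natDegree < n) :
    ∑ i ∈ Finset.range m, (U * P).coeff i ^ 2 ≤ M * ∑ i ∈ Finset.range n, U.coeff i ^ 2 := by
  have key : ∀ (Q : ℝ[X]) {k : ℕ}, Q.natDegree < k → ∑ i ∈ Finset.range k, Q.coeff i ^ 2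
      = Real.circleAverage (fun θ => ‖aeval θ Q‖ ^ 2) 0 1 := by
    intro Q k hk
    have h := (Q.map (algebraMap ℝ ℂ)).sum_sq_norm_coeff_eq_circleAverage
    simp only [eval_map_algebraMap] at h
    rw [← h]
    symm
    calc _ = ∑ i ∈ (Q.map (algebraMap ℝ ℂ)).support, Q.coeff i ^ 2 :=
          Finset.sum_congr rfl fun i _ => by simp
      _ = _ := by
          refine Finset.sum_subset (fun i hi => ?_) fun i _ hi => ?_
          · rw [Finset.mem_range]
            refine lt_of_le_of_lt (le_natDegree_of_mem_supp i hi) ?_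
            rwa [natDegree_map]
          · simpa using hi
  have hc : ∀ Q : ℝ[X], CircleIntegrable (fun θ => ‖aeval θ Q‖ ^ 2) 0 1 := fun Q =>
    ((Q.continuous_aeval.norm.pow 2).continuousOn).circleIntegrable zero_le_one
  rw [key _ hm, key _ hn, ← smul_eq_mul M, ← Real.circleAverage_fun_smul]
  refine Real.circleAverage_mono (hc _) ((hc U).const_fun_smul (a := M)) fun z hz => ?_
  simp only [map_mul, norm_mul, mul_pow, smul_eq_mul]
  rw [mul_comm]
  exact mul_le_mul_of_nonneg_right (hP z (by simpa using hz)) (by positivity)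

variable {a e : ℤ → H} {q : ℝ[X]} {K v : ℝ}

/-- A bounded solution of an autoregression is causal: it lies in the closed span of the present
and past innovations. -/
lemma mem_closure_span_of_autoregression (hq : ∀ z : ℂ, ‖z‖ ≤ 1 → aeval z q ≠ 0)
    (hK : ∀ t, ‖a t‖ ≤ K) (hae : aeval backShift q a = e) (t : ℤ) :
    a t ∈ (Submodule.span ℝ (e '' Set.Iic t)).topologicalClosure := by
  rw [← SetLike.mem_coe, Submodule.topologicalClosure_coe, Metric.mem_closure_iff]
  intro ε hε
  have hK0 : 0 ≤ K := (norm_nonneg _).trans (hK 0)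
  obtain ⟨P, hP⟩ := exists_coeffNorm_mul_sub_one_lt q hq (ε := ε / (K + 1)) (by positivity)
  refine ⟨aeval backShift P e t, ?_, ?_⟩
  · rw [aeval_backShift_apply P e t (Nat.lt_succ_self _)]
    exact Submodule.sum_mem _ fun i _ => Submodule.smul_mem _ _
      (Submodule.subset_span ⟨_, by simp, rfl⟩)
  · have h1 : aeval backShift P e t - a t = aeval backShift (P * q - 1) a t := by
      rw [← hae]; simp
    rw [dist_comm, dist_eq_norm, h1]
    calc _ ≤ coeffNorm (P * q - 1) * K := norm_aeval_backShift_le _ hK t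
      _ ≤ ε / (K + 1) * K := mul_le_mul_of_nonneg_right hP.le hK0
      _ < ε / (K + 1) * (K + 1) := by gcongr; linarith
      _ = ε := by field_simp

/-- The spectral bound: linear combinations of a bounded solution of an autoregression with
orthogonal innovations of variance `v` have variance at most `v / m` per unit of squared
coefficients, if `m` bounds the squared modulus of the associated polynomial on the circle from
below. -/
lemma norm_sq_aeval_backShift_le_of_autoregression (hq : ∀ z : ℂ, ‖z‖ ≤ 1 → aeval z q ≠ 0)
    (hK : ∀ t, ‖a t‖ ≤ K) (hae : aeval backShift q a = e) (hv : 0 ≤ v)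
    (he : ∀ s t, inner ℝ (e s) (e t) = if s = t then v else 0) {m : ℝ} (hm : 0 < m)
    (hmq : ∀ z : ℂ, ‖z‖ = 1 → m ≤ ‖aeval z q‖ ^ 2) (U : ℝ[X]) (t : ℤ) {n : ℕ}
    (hn : U.natDegree < n) :
    ‖aeval backShift U a t‖ ^ 2 ≤ v / m * ∑ i ∈ Finset.range n, U.coeff i ^ 2 := by
  set S := ∑ i ∈ Finset.range n, U.coeff i ^ 2 with hS
  have hS0 : 0 ≤ S := by positivity
  have hK0 : 0 ≤ K := (norm_nonneg _).trans (hK 0)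
  have key : ∀ ε : ℝ, 0 < ε → ‖aeval backShift U a t‖
      ≤ (1 + ε) * √(v / m * S) + coeffNorm U * (ε * K) := by
    intro ε hε
    obtain ⟨P, hP⟩ := exists_coeffNorm_mul_sub_one_lt q hq hε
    have hPz : ∀ z : ℂ, ‖z‖ = 1 → ‖aeval z P‖ ^ 2 ≤ (1 + ε) ^ 2 / m := by
      intro z hz
      have h1 : ‖aeval z (P * q - 1)‖ ≤ ε := by
        refine le_trans ?_ hP.le
        rw [aeval_eq_sum_range, coeffNorm_eq_sum_range _ (Nat.lt_succ_self _)]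
        refine (norm_sum_le _ _).trans (Finset.sum_le_sum fun i _ => ?_)
        rw [norm_smul, norm_pow, hz, one_pow, mul_one]
      rw [map_sub, map_mul, map_one] at h1
      have h2 : ‖aeval z P * aeval z q‖ ≤ 1 + ε := by
        calc _ = ‖1 + (aeval z P * aeval z q - 1)‖ := by congr 1; ring
          _ ≤ _ := (norm_add_le _ _).trans (by rw [norm_one]; linarith)
      rw [le_div_iff₀ hm]
      calc _ ≤ ‖aeval z P‖ ^ 2 * ‖aeval z q‖ ^ 2 :=
            mul_le_mul_of_nonneg_left (hmq z hz) (by positivity)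
        _ = ‖aeval z P * aeval z q‖ ^ 2 := by rw [norm_mul, mul_pow]
        _ ≤ _ := pow_le_pow_left₀ (norm_nonneg _) h2 2
    -- `U a = U P e - U (P q - 1) a`, and the last term is small
    have h1 : aeval backShift U a t = aeval backShift (U * P) e t
        - aeval backShift U (aeval backShift (P * q - 1) a) t := by
      rw [← hae]; simp
    have h2 : ‖aeval backShift (U * P) e t‖ ≤ (1 + ε) * √(v / m * S) := by
      have h3 := norm_sq_aeval_backShift he (U * P) t (Nat.lt_succ_self _)
      have h4 := mul_le_mul_of_nonneg_left
        (sum_sq_coeff_mul_le U P hPz (Nat.lt_succ_self _) hn) hv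
      refine abs_le_of_sq_le_sq' ?_ (by positivity) |>.2
      rw [h3, mul_pow, Real.sq_sqrt (by positivity)]
      refine h4.trans (le_of_eq ?_)
      rw [← hS]
      field_simp
    rw [h1]
    refine (norm_sub_le _ _).trans (add_le_add h2 ?_)
    refine norm_aeval_backShift_le U (fun s => ?_) t
    exact (norm_aeval_backShift_le _ hK s).trans (mul_le_mul_of_nonneg_right hP.le hK0)
  -- the approximation of the inverse is arbitrarily good
  have hlim : Tendsto (fun ε : ℝ => (1 + ε) * √(v / m * S) + coeffNorm U * (ε * K)) (𝓝[>] 0)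
      (𝓝 ((1 + 0) * √(v / m * S) + coeffNorm U * (0 * K))) :=
    (Continuous.tendsto (by fun_prop) 0).mono_left nhdsWithin_le_nhds
  have h := ge_of_tendsto hlim (eventually_mem_nhdsWithin.mono key)
  simp only [add_zero, one_mul, zero_mul, mul_zero] at h
  calc _ ≤ √(v / m * S) ^ 2 := pow_le_pow_left₀ (norm_nonneg _) h 2
    _ = _ := Real.sq_sqrt (by positivity)

end Autoregression

/-! ### Exponential moments of martingale transforms of Gaussian noise -/

section Concentration

lemma lintegral_exp_mul_sq_gaussianReal_le {x : ℝ} (h0 : 0 ≤ x) (h1 : x ≤ 1 / 4) :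
    ∫⁻ g, ENNReal.ofReal (Real.exp (x * g ^ 2)) ∂(gaussianReal 0 1)
      ≤ ENNReal.ofReal (Real.exp (2 * x)) := by
  rw [gaussianReal_of_var_ne_zero _ one_ne_zero,
    lintegral_withDensity_eq_lintegral_mul _ (measurable_gaussianPDF 0 1) (by fun_prop)]
  have hb : 0 < 1 / 2 - x := by linarith
  have h2 : ∀ g : ℝ, (gaussianPDF 0 1 * fun g => ENNReal.ofReal (Real.exp (x * g ^ 2))) g
      = ENNReal.ofReal ((√(2 * Real.pi))⁻¹ * Real.exp (-(1 / 2 - x) * g ^ 2)) := by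
    intro g
    rw [Pi.mul_apply, gaussianPDF, gaussianPDFReal, ← ENNReal.ofReal_mul (by positivity)]
    congr 1
    simp only [NNReal.coe_one, mul_one, sub_zero]
    rw [mul_assoc, ← Real.exp_add]
    congr 2
    ring
  simp_rw [h2]
  rw [← ofReal_integral_eq_lintegral_ofReal ((integrable_exp_neg_mul_sq hb).const_mul _)
    (ae_of_all _ fun _ => by positivity), integral_const_mul, integral_gaussian]
  refine ENNReal.ofReal_le_ofReal ?_
  have hpi := Real.pi_pos
  rw [← Real.sqrt_inv, ← Real.sqrt_mul (by positivity)]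
  have h3 : (2 * Real.pi)⁻¹ * (Real.pi / (1 / 2 - x)) = (1 - 2 * x)⁻¹ := by
    field_simp
  rw [h3]
  refine Real.sqrt_le_iff.2 ⟨(Real.exp_pos _).le, ?_⟩
  rw [← Real.exp_nat_mul, inv_le_iff_one_le_mul₀ (by linarith)]
  have h4 := Real.add_one_le_exp ((2 : ℕ) * (2 * x))
  push_cast at h4 ⊢
  nlinarith

variable {Ω : Type*} [MeasurableSpace Ω] {μ : Measure Ω}

lemma coeFn_sum_smul {J : Type*} [Fintype J] (u : J → ℝ) (A : J → Lp ℝ 2 μ) :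
    (∑ j, u j • A j : Lp ℝ 2 μ) =ᵐ[μ] fun ω => ∑ j, u j * A j ω := by
  have h3 : ∀ᵐ ω ∂μ, ∀ j, (u j • A j : Lp ℝ 2 μ) ω = u j • A j ω :=
    ae_all_iff.2 fun s => Lp.coeFn_smul _ _
  filter_upwards [Lp.coeFn_finsetSum Finset.univ fun j => u j • A j, h3] with ω e1 e2
  rw [e1, Finset.sum_apply]
  exact Finset.sum_congr rfl fun j _ => by rw [e2, smul_eq_mul]

lemma IsGaussianSubspace.lintegral_exp_sum [IsProbabilityMeasure μ]
    {G : Submodule ℝ (Lp ℝ 2 μ)} (hG : IsGaussianSubspace G) {J : Type*} [Fintype J]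
    {A : J → Lp ℝ 2 μ} (hA : ∀ j, A j ∈ G) (u : J → ℝ) :
    ∫⁻ ω, ENNReal.ofReal (Real.exp (∑ j, u j * A j ω)) ∂μ
      = ENNReal.ofReal (Real.exp (‖∑ j, u j • A j‖ ^ 2 / 2)) := by
  rw [← hG.lintegral_exp (G.sum_mem fun j _ => G.smul_mem (u j) (hA j))]
  refine lintegral_congr_ae ?_
  filter_upwards [coeFn_sum_smul u A] with ω h
  rw [h]

/-- The exponential moment of the squared norm of a Gaussian vector whose covariance matrix is
bounded by `s`. The square is linearized by an auxiliary standard Gaussian vector `g`, via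
`exp (θ |A|²) = E exp (√(2θ) ⟨g, A⟩)`. -/
lemma IsGaussianSubspace.lintegral_exp_sum_sq_le [IsProbabilityMeasure μ]
    {G : Submodule ℝ (Lp ℝ 2 μ)} (hG : IsGaussianSubspace G) {J : Type*} [Fintype J]
    {A : J → Lp ℝ 2 μ} (hA : ∀ j, A j ∈ G) {s θ : ℝ} (hs : 0 ≤ s) (hθ : 0 ≤ θ)
    (hθs : 4 * (θ * s) ≤ 1) (hvar : ∀ u : J → ℝ, ‖∑ j, u j • A j‖ ^ 2 ≤ s * ∑ j, u j ^ 2) :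
    ∫⁻ ω, ENNReal.ofReal (Real.exp (θ * ∑ j, A j ω ^ 2)) ∂μ
      ≤ ENNReal.ofReal (Real.exp (2 * (θ * s) * Fintype.card J)) := by
  set γ : Measure (J → ℝ) := Measure.pi fun _ => gaussianReal 0 1 with hγ
  have hprod : ∀ f : J → ℝ → ℝ, (∀ j, Measurable (f j)) →
      ∫⁻ g, ENNReal.ofReal (Real.exp (∑ j, f j (g j))) ∂γ
        = ∏ j, ∫⁻ x, ENNReal.ofReal (Real.exp (f j x)) ∂(gaussianReal 0 1) := by
    intro f hf
    have hm : ∀ j, Measurable fun x => ENNReal.ofReal (Real.exp (f j x)) := fun j => by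
      have := hf j; fun_prop
    have h1 : iIndepFun (fun j (g : J → ℝ) => ENNReal.ofReal (Real.exp (f j (g j)))) γ :=
      iIndepFun_pi (fun j => (hm j).aemeasurable)
    have h2 := lintegral_prod_eq_prod_lintegral_of_indepFun Finset.univ _ h1
      (fun j => (hm j).comp (measurable_pi_apply j))
    simp only [Real.exp_sum]
    simp_rw [ENNReal.ofReal_prod_of_nonneg (fun _ _ => (Real.exp_pos _).le)]
    rw [h2]
    refine Finset.prod_congr rfl fun j _ => ?_
    exact (measurePreserving_eval (fun _ : J => gaussianReal 0 1) j).lintegral_comp (hm j)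
  have hlin : ∀ b : J → ℝ, ∫⁻ g, ENNReal.ofReal (Real.exp (∑ j, √(2 * θ) * b j * g j)) ∂γ
      = ENNReal.ofReal (Real.exp (θ * ∑ j, b j ^ 2)) := by
    intro b
    rw [hprod (fun j x => √(2 * θ) * b j * x) (fun j => by fun_prop), Finset.mul_sum, Real.exp_sum,
      ENNReal.ofReal_prod_of_nonneg (fun _ _ => (Real.exp_pos _).le)]
    refine Finset.prod_congr rfl fun j _ => ?_
    have h := congrFun (mgf_id_gaussianReal (μ := 0) (v := 1)) (√(2 * θ) * b j)
    simp only [mgf, id] at h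
    rw [← ofReal_integral_eq_lintegral_ofReal, h]
    · congr 2
      rw [mul_pow, Real.sq_sqrt (by positivity)]
      push_cast
      ring
    -- a non-integrable exponential would have the junk integral `0`
    · by_contra hc
      rw [integral_undef hc] at h
      exact (Real.exp_pos _).ne h
    · exact ae_of_all _ fun _ => (Real.exp_pos _).le
  have hAm : ∀ j, Measurable (A j) := fun j => (Lp.stronglyMeasurable (A j)).measurable
  calc _ = ∫⁻ ω, ∫⁻ g, ENNReal.ofReal (Real.exp (∑ j, √(2 * θ) * A j ω * g j)) ∂γ ∂μ :=
        lintegral_congr fun ω => (hlin fun j => A j ω).symm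
    _ = ∫⁻ g, ∫⁻ ω, ENNReal.ofReal (Real.exp (∑ j, √(2 * θ) * A j ω * g j)) ∂μ ∂γ := by
        refine lintegral_lintegral_swap (Measurable.aemeasurable ?_)
        simp only [Function.uncurry_def]
        fun_prop
    _ ≤ ∫⁻ g, ENNReal.ofReal (Real.exp (∑ j, θ * s * g j ^ 2)) ∂γ := by
        refine lintegral_mono fun g => ?_
        have h1 := hG.lintegral_exp_sum hA fun j => √(2 * θ) * g j
        have h2 : ∀ ω, ∑ j, √(2 * θ) * A j ω * g j = ∑ j, √(2 * θ) * g j * A j ω := fun ω =>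
          Finset.sum_congr rfl fun j _ => by ring
        simp_rw [h2]
        rw [h1]
        refine ENNReal.ofReal_le_ofReal (Real.exp_le_exp.2 ?_)
        have h3 := hvar fun j => √(2 * θ) * g j
        simp_rw [mul_pow, Real.sq_sqrt (show (0 : ℝ) ≤ 2 * θ by positivity)] at h3
        rw [← Finset.mul_sum] at h3 ⊢
        linarith
    _ = ∏ _j : J, ∫⁻ x, ENNReal.ofReal (Real.exp (θ * s * x ^ 2)) ∂(gaussianReal 0 1) :=
        hprod (fun _ x => θ * s * x ^ 2) (fun j => by fun_prop)
    _ ≤ ∏ _j : J, ENNReal.ofReal (Real.exp (2 * (θ * s))) := by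
        refine Finset.prod_le_prod' fun j _ => ?_
        exact lintegral_exp_mul_sq_gaussianReal_le (by positivity) (by linarith)
    _ = _ := by
        rw [Finset.prod_const, ← ENNReal.ofReal_pow (Real.exp_pos _).le, ← Real.exp_nat_mul,
          Finset.card_univ, mul_comm]

/-- One step of the exponential martingale. -/
lemma lintegral_exp_add_sub_eq [IsProbabilityMeasure μ] {ι : Type*} [Fintype ι] {W : Ω → ℝ}
    {x y : Ω → ι → ℝ} (hW : Measurable W) (hx : Measurable x) (hy : Measurable y)
    (hi : IndepFun (fun ω => (W ω, x ω)) y μ) {v : ℝ}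
    (hmgf : ∀ c : ι → ℝ, ∫⁻ ω, ENNReal.ofReal (Real.exp (∑ m, c m * y ω m)) ∂μ
      = ENNReal.ofReal (Real.exp (v / 2 * ∑ m, c m ^ 2))) :
    ∫⁻ ω, ENNReal.ofReal (Real.exp (W ω + (∑ m, x ω m * y ω m - v / 2 * ∑ m, x ω m ^ 2))) ∂μ
      = ∫⁻ ω, ENNReal.ofReal (Real.exp (W ω)) ∂μ := by
  let F : (ℝ × (ι → ℝ)) × (ι → ℝ) → ENNReal := fun q =>
    ENNReal.ofReal (Real.exp (q.1.1 + (∑ m, q.1.2 m * q.2 m - v / 2 * ∑ m, q.1.2 m ^ 2)))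
  have hF : Measurable F := by fun_prop
  have hWx : Measurable fun ω => (W ω, x ω) := hW.prodMk hx
  have hprob : IsProbabilityMeasure (μ.map y) := Measure.isProbabilityMeasure_map hy.aemeasurable
  have hprob' : IsProbabilityMeasure (μ.map fun ω => (W ω, x ω)) :=
    Measure.isProbabilityMeasure_map hWx.aemeasurable
  calc _ = ∫⁻ q, F q ∂(μ.map fun ω => ((W ω, x ω), y ω)) :=
        (lintegral_map hF (hWx.prodMk hy)).symm
    _ = ∫⁻ q, ∫⁻ z, F (q, z) ∂(μ.map y) ∂(μ.map fun ω => (W ω, x ω)) := by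
        rw [hi.map_prod_eq_prod_map_map hWx.aemeasurable hy.aemeasurable,
          lintegral_prod _ hF.aemeasurable]
    _ = ∫⁻ q, ENNReal.ofReal (Real.exp q.1) ∂(μ.map fun ω => (W ω, x ω)) := by
        refine lintegral_congr fun q => ?_
        rw [lintegral_map (by fun_prop) hy]
        have h1 : ∀ ω, F (q, y ω) = ENNReal.ofReal (Real.exp (q.1 - v / 2 * ∑ m, q.2 m ^ 2))
            * ENNReal.ofReal (Real.exp (∑ m, q.2 m * y ω m)) := by
          intro ω
          rw [← ENNReal.ofReal_mul (Real.exp_pos _).le, ← Real.exp_add]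
          simp only [F]
          congr 2
          ring
        simp_rw [h1]
        rw [lintegral_const_mul _ (by fun_prop), hmgf, ← ENNReal.ofReal_mul (Real.exp_pos _).le,
          ← Real.exp_add]
        congr 2
        ring
    _ = _ := lintegral_map (by fun_prop) hWx

/-- The Chernoff bound for both tails. -/
lemma measure_lt_abs_le_of_lintegral_exp_le {S : Ω → ℝ} (hS : Measurable S) {t b y : ℝ} (ht : 0 < t)
    (h : ∀ t', t' ^ 2 = t ^ 2 → ∫⁻ ω, ENNReal.ofReal (Real.exp (t' * S ω)) ∂μ
      ≤ ENNReal.ofReal (Real.exp b)) :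
    μ {ω | y < |S ω|} ≤ ENNReal.ofReal (2 * Real.exp (b - t * y)) := by
  have key : ∀ t', t' ^ 2 = t ^ 2 → μ {ω | t * y ≤ t' * S ω}
      ≤ ENNReal.ofReal (Real.exp (b - t * y)) := by
    intro t' ht'
    have h1 := mul_meas_ge_le_lintegral (μ := μ)
      (f := fun ω => ENNReal.ofReal (Real.exp (t' * S ω))) (by fun_prop)
      (ENNReal.ofReal (Real.exp (t * y)))
    have h2 : {ω | ENNReal.ofReal (Real.exp (t * y)) ≤ ENNReal.ofReal (Real.exp (t' * S ω))}
        = {ω | t * y ≤ t' * S ω} := by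
      ext ω
      simp [ENNReal.ofReal_le_ofReal_iff (Real.exp_pos _).le]
    rw [h2] at h1
    rw [Real.exp_sub, ENNReal.ofReal_div_of_pos (Real.exp_pos _),
      ENNReal.le_div_iff_mul_le (Or.inl (by simp [Real.exp_pos])) (Or.inl (by simp)), mul_comm]
    exact h1.trans (h t' ht')
  have hsub : {ω | y < |S ω|} ⊆ {ω | t * y ≤ t * S ω} ∪ {ω | t * y ≤ -t * S ω} := by
    intro ω hω
    rcases lt_abs.1 (show y < |S ω| from hω) with h | h
    · exact Or.inl (mul_le_mul_of_nonneg_left h.le ht.le)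
    · refine Or.inr ?_
      show t * y ≤ -t * S ω
      nlinarith
  calc _ ≤ _ := measure_mono hsub
    _ ≤ _ := measure_union_le _ _
    _ ≤ _ := add_le_add (key t rfl) (key (-t) (by ring))
    _ = _ := by
      rw [← ENNReal.ofReal_add (Real.exp_pos _).le (Real.exp_pos _).le]
      congr 1
      ring

variable [IsProbabilityMeasure μ] {G : Submodule ℝ (Lp ℝ 2 μ)} {ι : Type*} [Fintype ι]
  {X E : ℕ → ι → Lp ℝ 2 μ} {v : ℝ}

/-- The exponential martingale of `∑ ⟨X r, E r⟩`, for Gaussian white noise `E` and a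
non-anticipating Gaussian sequence `X`. -/
lemma IsGaussianSubspace.lintegral_exp_martingale (hG : IsGaussianSubspace G)
    (hX : ∀ r m, X r m ∈ G) (hE : ∀ r m, E r m ∈ G) [DecidableEq ι]
    (hEE : ∀ r m r' m', inner ℝ (E r m) (E r' m') = if r = r' ∧ m = m' then v else 0)
    (hXE : ∀ r m r' m', r ≤ r' → inner ℝ (X r m) (E r' m') = 0) (n : ℕ) :
    ∫⁻ ω, ENNReal.ofReal (Real.exp (∑ r ∈ Finset.range n,
      (∑ m, X r m ω * E r m ω - v / 2 * ∑ m, X r m ω ^ 2))) ∂μ = 1 := by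
  have hXm : ∀ r m, Measurable (X r m) := fun r m => (Lp.stronglyMeasurable _).measurable
  have hEm : ∀ r m, Measurable (E r m) := fun r m => (Lp.stronglyMeasurable _).measurable
  induction n with
  | zero => simp
  | succ n ih =>
    simp_rw [Finset.sum_range_succ]
    rw [← ih]
    refine lintegral_exp_add_sub_eq (x := fun ω m => X n m ω) (y := fun ω m => E n m ω)
      (by fun_prop) (by fun_prop) (by fun_prop) ?_ fun c => ?_
    · let F : (Finset.range (n + 1) × ι) ⊕ (Finset.range n × ι) → Lp ℝ 2 μ :=
        Sum.elim (fun q => X q.1 q.2) (fun q => E q.1 q.2)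
      have hi := hG.indepFun (F := F) (F' := E n) (by rintro (q | q) <;> simp [F, hX, hE]) (hE n)
        (by
          rintro (⟨⟨r, hr⟩, m⟩ | ⟨⟨r, hr⟩, m⟩) m'
          · exact hXE r m n m' (by simpa [Nat.lt_succ_iff] using hr)
          · have : r ≠ n := by simp at hr; omega
            simp [F, hEE, this])
      -- the first `n` terms and the next coefficient, as functions of the past
      let Ψ : ((Finset.range (n + 1) × ι) ⊕ (Finset.range n × ι) → ℝ) → ℝ × (ι → ℝ) := fun z =>
        (∑ r : Finset.range n, (∑ m, z (.inl (⟨r, Finset.mem_range.2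
            ((Finset.mem_range.1 r.2).trans n.lt_succ_self)⟩, m)) * z (.inr (r, m))
            - v / 2 * ∑ m, z (.inl (⟨r, Finset.mem_range.2
            ((Finset.mem_range.1 r.2).trans n.lt_succ_self)⟩, m)) ^ 2),
          fun m => z (.inl (⟨n, Finset.self_mem_range_succ n⟩, m)))
      have hΨ : Measurable Ψ := by fun_prop
      have := hi.comp hΨ measurable_id
      convert this using 1
      ext ω
      · simp only [Ψ, F, Function.comp_apply, Sum.elim_inl, Sum.elim_inr]
        exact (Finset.sum_coe_sort (Finset.range n)
          fun r => ∑ m, X r m ω * E r m ω - v / 2 * ∑ m, X r m ω ^ 2).symm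
      · rfl
      · rfl
    · rw [hG.lintegral_exp_sum (hE n)]
      congr 2
      rw [← real_inner_self_eq_norm_sq, sum_inner]
      simp_rw [inner_sum, inner_smul_left, inner_smul_right, hEE]
      simp
      rw [Finset.mul_sum, Finset.sum_div]
      exact Finset.sum_congr rfl fun m _ => by ring

/-- The martingale transform `∑ ⟨X r, E r⟩` is sub-Gaussian near the origin, with variance proxy
the product of the noise variance `v`, the bound `s` on the covariance of `X`, and the number of
summands. By the inequality `2 x y ≤ x² + y²`, this reduces to the exponential martingale of `2 X` and
to the exponential moment of the squared norm of `X`. -/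
lemma IsGaussianSubspace.lintegral_exp_sum_mul_le (hG : IsGaussianSubspace G)
    (hX : ∀ r m, X r m ∈ G) (hE : ∀ r m, E r m ∈ G) [DecidableEq ι]
    (hEE : ∀ r m r' m', inner ℝ (E r m) (E r' m') = if r = r' ∧ m = m' then v else 0)
    (hXE : ∀ r m r' m', r ≤ r' → inner ℝ (X r m) (E r' m') = 0) (n : ℕ) {s : ℝ} (hs : 0 ≤ s)
    (hv : 0 ≤ v)
    (hvar : ∀ u : Fin n × ι → ℝ, ‖∑ j, u j • X j.1 j.2‖ ^ 2 ≤ s * ∑ j, u j ^ 2) {t : ℝ}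
    (ht : 8 * (t ^ 2 * (v * s)) ≤ 1) :
    ∫⁻ ω, ENNReal.ofReal (Real.exp (t * ∑ j : Fin n × ι, X j.1 j.2 ω * E j.1 j.2 ω)) ∂μ
      ≤ ENNReal.ofReal (Real.exp (2 * (t ^ 2 * (v * s)) * (n * Fintype.card ι))) := by
  have hXm : ∀ r m, Measurable (X r m) := fun r m => (Lp.stronglyMeasurable _).measurable
  have hEm : ∀ r m, Measurable (E r m) := fun r m => (Lp.stronglyMeasurable _).measurable
  set β : ℝ := 2 * (t ^ 2 * (v * s)) * (n * Fintype.card ι) with hβ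
  let S : Ω → ℝ := fun ω => ∑ j : Fin n × ι, X j.1 j.2 ω * E j.1 j.2 ω
  let Q : Ω → ℝ := fun ω => ∑ j : Fin n × ι, X j.1 j.2 ω ^ 2
  have hSm : Measurable S := by fun_prop
  have hQm : Measurable Q := by fun_prop
  have h1 : ∫⁻ ω, ENNReal.ofReal (Real.exp (2 * t * S ω - 2 * t ^ 2 * v * Q ω)) ∂μ = 1 := by
    rw [← hG.lintegral_exp_martingale (X := fun r m => (2 * t) • X r m) (E := E)
      (fun r m => G.smul_mem _ (hX r m)) hE hEE
      (fun r m r' m' h => by rw [inner_smul_left, hXE r m r' m' h, mul_zero]) n]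
    refine lintegral_congr_ae ?_
    have h3 : ∀ᵐ ω ∂μ, ∀ r m, ((2 * t) • X r m : Lp ℝ 2 μ) ω = (2 * t) • X r m ω :=
      ae_all_iff.2 fun r => ae_all_iff.2 fun m => Lp.coeFn_smul _ _
    filter_upwards [h3] with ω h
    congr 2
    simp only [S, Q, h, smul_eq_mul]
    rw [Finset.sum_range (fun r => ∑ m, 2 * t * X r m ω * E r m ω
      - v / 2 * ∑ m, (2 * t * X r m ω) ^ 2), Finset.sum_sub_distrib, Fintype.sum_prod_type,
      Fintype.sum_prod_type]
    simp only [Finset.mul_sum]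
    congr 1
    · exact Finset.sum_congr rfl fun r _ => Finset.sum_congr rfl fun m _ => by ring
    · exact Finset.sum_congr rfl fun r _ => Finset.sum_congr rfl fun m _ => by ring
  have h2 : ∫⁻ ω, ENNReal.ofReal (Real.exp (2 * t ^ 2 * v * Q ω)) ∂μ
      ≤ ENNReal.ofReal (Real.exp (2 * β)) := by
    refine (hG.lintegral_exp_sum_sq_le (A := fun j : Fin n × ι => X j.1 j.2)
      (fun j => hX _ _) hs (θ := 2 * t ^ 2 * v) (by positivity) (by linarith) hvar).trans
      (le_of_eq ?_)
    congr 2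
    rw [hβ, Fintype.card_prod, Fintype.card_fin]
    push_cast
    ring
  -- the weights `exp (± β)` balance the expectations of the two terms
  have hpt : ∀ ω, ENNReal.ofReal (Real.exp (t * S ω))
      ≤ ENNReal.ofReal (Real.exp β / 2)
          * ENNReal.ofReal (Real.exp (2 * t * S ω - 2 * t ^ 2 * v * Q ω))
        + ENNReal.ofReal (Real.exp (-β) / 2) * ENNReal.ofReal (Real.exp (2 * t ^ 2 * v * Q ω)) := by
    intro ω
    rw [← ENNReal.ofReal_mul (by positivity), ← ENNReal.ofReal_mul (by positivity),
      ← ENNReal.ofReal_add (by positivity) (by positivity)]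
    refine ENNReal.ofReal_le_ofReal ?_
    have h := two_mul_le_add_sq (Real.exp (β / 2 + (t * S ω - t ^ 2 * v * Q ω)))
      (Real.exp (-β / 2 + t ^ 2 * v * Q ω))
    rw [mul_assoc, ← Real.exp_add, ← Real.exp_nat_mul, ← Real.exp_nat_mul] at h
    rw [div_mul_eq_mul_div, div_mul_eq_mul_div, ← Real.exp_add, ← Real.exp_add]
    have e1 : β / 2 + (t * S ω - t ^ 2 * v * Q ω) + (-β / 2 + t ^ 2 * v * Q ω) = t * S ω := by ring
    have e2 : ((2 : ℕ) : ℝ) * (β / 2 + (t * S ω - t ^ 2 * v * Q ω))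
        = β + (2 * t * S ω - 2 * t ^ 2 * v * Q ω) := by push_cast; ring
    have e3 : ((2 : ℕ) : ℝ) * (-β / 2 + t ^ 2 * v * Q ω) = -β + 2 * t ^ 2 * v * Q ω := by
      push_cast; ring
    rw [e1, e2, e3] at h
    linarith
  calc _ ≤ _ := lintegral_mono hpt
    _ = ENNReal.ofReal (Real.exp β / 2) * 1 + ENNReal.ofReal (Real.exp (-β) / 2)
          * ∫⁻ ω, ENNReal.ofReal (Real.exp (2 * t ^ 2 * v * Q ω)) ∂μ := by
        rw [lintegral_add_left (by fun_prop), lintegral_const_mul _ (by fun_prop),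
          lintegral_const_mul _ (by fun_prop), h1]
    _ ≤ ENNReal.ofReal (Real.exp β / 2) * 1 + ENNReal.ofReal (Real.exp (-β) / 2)
          * ENNReal.ofReal (Real.exp (2 * β)) := by gcongr
    _ = ENNReal.ofReal (Real.exp β) := by
        rw [mul_one, ← ENNReal.ofReal_mul (by positivity),
          ← ENNReal.ofReal_add (by positivity) (by positivity), div_mul_eq_mul_div, ← Real.exp_add]
        congr 1
        rw [show -β + 2 * β = β by ring]
        ring

end Concentration

/-! ### Integrating a square-integrable random field against a weight -/

section WeightedIntegral

variable {Ω S : Type*} [MeasurableSpace Ω] [MeasurableSpace S] {μ : Measure Ω} {σ : Measure S}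

lemma inner_toLp_toLp {f g : Ω → ℝ} (hf : MemLp f 2 μ) (hg : MemLp g 2 μ) :
    inner ℝ hf.toLp hg.toLp = ∫ ω, f ω * g ω ∂μ := by
  rw [L2.inner_def]
  refine integral_congr_ae ?_
  filter_upwards [hf.coeFn_toLp, hg.coeFn_toLp] with ω h1 h2
  rw [h1, h2]
  simp [mul_comm]

lemma sq_integral_mul_le {f g : Ω → ℝ} (hf : MemLp f 2 μ) (hg : MemLp g 2 μ) :
    (∫ ω, f ω * g ω ∂μ) ^ 2 ≤ (∫ ω, f ω ^ 2 ∂μ) * ∫ ω, g ω ^ 2 ∂μ := by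
  have h := real_inner_mul_inner_self_le hf.toLp hg.toLp
  simp only [inner_toLp_toLp] at h
  simpa only [sq] using h

variable [IsFiniteMeasure σ] [IsProbabilityMeasure μ] {X : S → Ω → ℝ} {y : S → ℝ}

lemma ae_memLp_section (hX : MemLp (fun q : S × Ω => X q.1 q.2) 2 (σ.prod μ)) :
    ∀ᵐ ω ∂μ, MemLp (fun x => X x ω) 2 σ := by
  filter_upwards [hX.integrable_sq.prod_left_ae, hX.1.prodMk_right] with ω h1 h2
  exact (memLp_two_iff_integrable_sq h2).2 h1

lemma ae_sq_integral_mul_le (hX : MemLp (fun q : S × Ω => X q.1 q.2) 2 (σ.prod μ))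
    (hy : MemLp y 2 σ) :
    ∀ᵐ ω ∂μ, (∫ x, X x ω * y x ∂σ) ^ 2 ≤ (∫ x, X x ω ^ 2 ∂σ) * ∫ x, y x ^ 2 ∂σ := by
  filter_upwards [ae_memLp_section hX] with ω h
  exact sq_integral_mul_le h hy

lemma memLp_integral_mul (hX : MemLp (fun q : S × Ω => X q.1 q.2) 2 (σ.prod μ))
    (hy : MemLp y 2 σ) : MemLp (fun ω => ∫ x, X x ω * y x ∂σ) 2 μ := by
  have hm : AEStronglyMeasurable (fun ω => ∫ x, X x ω * y x ∂σ) μ :=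
    (hX.1.mul (hy.1.comp_fst)).prod_swap.integral_prod_right'
  rw [memLp_two_iff_integrable_sq hm]
  refine Integrable.mono' (hX.integrable_sq.integral_prod_right.mul_const (∫ x, y x ^ 2 ∂σ))
    (hm.pow 2) ?_
  filter_upwards [ae_sq_integral_mul_le hX hy] with ω h
  rwa [Real.norm_of_nonneg (sq_nonneg _)]

lemma integral_sq_integral_mul_le (hX : MemLp (fun q : S × Ω => X q.1 q.2) 2 (σ.prod μ))
    (hy : MemLp y 2 σ) :
    ∫ ω, (∫ x, X x ω * y x ∂σ) ^ 2 ∂μ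
      ≤ (∫ q, X q.1 q.2 ^ 2 ∂(σ.prod μ)) * ∫ x, y x ^ 2 ∂σ := by
  rw [integral_prod_symm _ hX.integrable_sq, ← integral_mul_const]
  exact integral_mono_ae (memLp_integral_mul hX hy).integrable_sq
    (hX.integrable_sq.integral_prod_right.mul_const _) (ae_sq_integral_mul_le hX hy)

lemma integral_integral_mul_mul (hX : MemLp (fun q : S × Ω => X q.1 q.2) 2 (σ.prod μ))
    (hy : MemLp y 2 σ) {η : Ω → ℝ} (hη : MemLp η 2 μ) :
    ∫ ω, (∫ x, X x ω * y x ∂σ) * η ω ∂μ = ∫ x, (∫ ω, X x ω * η ω ∂μ) * y x ∂σ := by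
  have h1 : MemLp (fun q : S × Ω => y q.1 * η q.2) 2 (σ.prod μ) := by
    have hm : AEStronglyMeasurable (fun q : S × Ω => y q.1 * η q.2) (σ.prod μ) :=
      hy.1.comp_fst.mul hη.1.comp_snd
    rw [memLp_two_iff_integrable_sq hm]
    simp_rw [mul_pow]
    exact hy.integrable_sq.mul_prod hη.integrable_sq
  have h2 : Integrable (Function.uncurry fun x ω => X x ω * (y x * η ω)) (σ.prod μ) :=
    hX.integrable_mul h1
  simp_rw [← integral_mul_const]
  calc _ = ∫ ω, ∫ x, X x ω * (y x * η ω) ∂σ ∂μ := by simp_rw [mul_assoc]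
    _ = ∫ x, ∫ ω, X x ω * (y x * η ω) ∂μ ∂σ := (integral_integral_swap h2).symm
    _ = _ := by simp_rw [mul_assoc, mul_comm]

/-- The integral of a random field against a weight belongs to the closed span of the field. This
follows by duality: a variable orthogonal to the field is orthogonal to the integral, by Fubini's
theorem. -/
lemma toLp_integral_mul_mem_closure_span
    (hX : MemLp (fun q : S × Ω => X q.1 q.2) 2 (σ.prod μ)) (hy : MemLp y 2 σ)
    (h2 : ∀ x, MemLp (X x) 2 μ) :
    (memLp_integral_mul hX hy).toLp
      ∈ (Submodule.span ℝ (Set.range fun x => (h2 x).toLp)).topologicalClosure := by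
  rw [← Submodule.orthogonal_orthogonal_eq_closure, Submodule.mem_orthogonal]
  intro η hη
  have h0 : ∀ x, ∫ ω, X x ω * η ω ∂μ = 0 := by
    intro x
    rw [← inner_toLp_toLp (h2 x) (Lp.memLp η), Lp.toLp_coeFn]
    exact (Submodule.mem_orthogonal _ _).1 hη _ (Submodule.subset_span ⟨x, rfl⟩)
  rw [real_inner_comm, ← Lp.toLp_coeFn η (Lp.memLp η), inner_toLp_toLp,
    integral_integral_mul_mul hX hy (Lp.memLp η)]
  simp [h0]

end WeightedIntegral

/-! ### Harmonic coefficients of fields on the sphere -/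

section Sphere

instance : IsFiniteMeasure surf := by unfold surf; infer_instance

lemma IsSphericalHarmonic.continuous {ℓ : ℕ} {f : S2 → ℝ} (hf : IsSphericalHarmonic ℓ f) :
    Continuous f := by
  obtain ⟨P, -, -, h⟩ := hf
  rw [show f = _ from funext h]
  exact P.continuous_eval.comp (continuous_pi fun i => by fun_prop)

lemma memLp_two_of_continuous {f : S2 → ℝ} (hf : Continuous f) : MemLp f 2 surf := by
  obtain ⟨M, hM⟩ := isCompact_univ.exists_bound_of_continuousOn hf.continuousOn
  exact MemLp.of_bound hf.aestronglyMeasurable M (ae_of_all _ fun x => hM x trivial)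

lemma integrable_of_continuous {f : S2 → ℝ} (hf : Continuous f) : Integrable f surf :=
  (memLp_two_of_continuous hf).integrable (by norm_num)

variable {Y : (ℓ : ℕ) → Fin (2 * ℓ + 1) → S2 → ℝ} {C : ℕ → ℝ}

lemma IsHarmonicBasis.continuous (hY : IsHarmonicBasis Y) (ℓ : ℕ) (m : Fin (2 * ℓ + 1)) :
    Continuous (Y ℓ m) :=
  (hY.harmonic ℓ m).continuous

lemma IsHarmonicBasis.integral_mul (hY : IsHarmonicBasis Y) (ℓ : ℕ) (m m' : Fin (2 * ℓ + 1)) :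
    ∫ x, Y ℓ m x * Y ℓ m' x ∂surf = if m = m' then 1 else 0 := by
  split_ifs with h
  · rw [h, hY.normalized]
  · exact hY.orthogonal ℓ m ℓ m' (by simpa using h)

lemma IsHarmonicBasis.integral_zonalKernel_self (hY : IsHarmonicBasis Y) (ℓ : ℕ) :
    ∫ x, zonalKernel Y ℓ x x ∂surf = 2 * ℓ + 1 := by
  simp only [zonalKernel]
  rw [integral_finsetSum]
  swap
  · exact fun m _ => integrable_of_continuous ((hY.continuous ℓ m).mul (hY.continuous ℓ m))
  simp [hY.normalized]

lemma zonalKernel_self_nonneg (Y : (ℓ : ℕ) → Fin (2 * ℓ + 1) → S2 → ℝ) (ℓ : ℕ) (x : S2) :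
    0 ≤ zonalKernel Y ℓ x x :=
  Finset.sum_nonneg fun _ _ => mul_self_nonneg _

/-- The elementary substitute for the addition formula: the zonal kernel is controlled by its
diagonal. -/
lemma abs_zonalKernel_le (Y : (ℓ : ℕ) → Fin (2 * ℓ + 1) → S2 → ℝ) (ℓ : ℕ) (x y : S2) :
    |zonalKernel Y ℓ x y| ≤ (zonalKernel Y ℓ x x + zonalKernel Y ℓ y y) / 2 := by
  rw [zonalKernel, zonalKernel, zonalKernel, ← Finset.sum_add_distrib, Finset.sum_div]
  refine (Finset.abs_sum_le_sum_abs _ _).trans (Finset.sum_le_sum fun m _ => ?_)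
  rw [abs_le]
  constructor <;> nlinarith [sq_nonneg (Y ℓ m x - Y ℓ m y), sq_nonneg (Y ℓ m x + Y ℓ m y)]

lemma IsHarmonicBasis.continuous_zonalKernel (hY : IsHarmonicBasis Y) (ℓ : ℕ) :
    Continuous fun q : S2 × S2 => zonalKernel Y ℓ q.1 q.2 := by
  simp only [zonalKernel]
  exact continuous_finsetSum _ fun m _ =>
    ((hY.continuous ℓ m).comp continuous_fst).mul ((hY.continuous ℓ m).comp continuous_snd)

lemma IsHarmonicBasis.integral_zonalKernel_mul (hY : IsHarmonicBasis Y) (ℓ' ℓ : ℕ)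
    (m : Fin (2 * ℓ + 1)) (x : S2) :
    ∫ y, zonalKernel Y ℓ' x y * Y ℓ m y ∂surf = if ℓ' = ℓ then Y ℓ m x else 0 := by
  simp only [zonalKernel, Finset.sum_mul, mul_assoc]
  rw [integral_finsetSum]
  swap
  · exact fun m' _ => (integrable_of_continuous
      ((hY.continuous ℓ' m').mul (hY.continuous ℓ m))).const_mul _
  simp_rw [integral_const_mul]
  split_ifs with h
  · subst h
    simp [hY.integral_mul]
  · refine Finset.sum_eq_zero fun m' _ => ?_
    rw [hY.orthogonal ℓ' m' ℓ m (by simp [h]), mul_zero]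

variable {Ω : Type*} [MeasurableSpace Ω] {μ : Measure Ω} {Z T : S2 → ℤ → Ω → ℝ}

namespace IsSphericalWhiteNoise

lemma summable_abs (hZ : IsSphericalWhiteNoise Y C μ Z) : Summable fun ℓ : ℕ => |C ℓ| * (2 * ℓ + 1) := by
  have h := (hZ.summable.abs).mul_left (4 * Real.pi)
  refine h.congr fun ℓ => ?_
  rw [abs_mul, abs_of_nonneg (by positivity)]
  field_simp

lemma memLp (hZ : IsSphericalWhiteNoise Y C μ Z) (x : S2) (t : ℤ) : MemLp (Z x t) 2 μ :=
  ((hZ.gaussian t).hasGaussianLaw_eval x).memLp_two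

lemma lintegral_tsum_abs_zonalKernel_lt_top (hZ : IsSphericalWhiteNoise Y C μ Z)
    (hY : IsHarmonicBasis Y) :
    ∫⁻ x, ∑' ℓ, ENNReal.ofReal (|C ℓ| * zonalKernel Y ℓ x x) ∂surf < ⊤ := by
  have hint : ∀ ℓ, Integrable (fun x => |C ℓ| * zonalKernel Y ℓ x x) surf := fun ℓ =>
    (integrable_of_continuous ((hY.continuous_zonalKernel ℓ).comp
      (by fun_prop : Continuous fun x : S2 => (x, x)))).const_mul _
  calc _ = ∑' ℓ, ∫⁻ x, ENNReal.ofReal (|C ℓ| * zonalKernel Y ℓ x x) ∂surf :=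
        lintegral_tsum fun ℓ => (hint ℓ).1.aemeasurable.ennreal_ofReal
    _ = ∑' ℓ : ℕ, ENNReal.ofReal (|C ℓ| * (2 * ℓ + 1)) := by
        refine tsum_congr fun ℓ => ?_
        rw [← ofReal_integral_eq_lintegral_ofReal (hint ℓ) (ae_of_all _ fun x =>
          mul_nonneg (abs_nonneg _) (zonalKernel_self_nonneg Y ℓ x)), integral_const_mul,
          hY.integral_zonalKernel_self]
    _ < ⊤ := by
        rw [← ENNReal.ofReal_tsum_of_nonneg (fun ℓ => by positivity) hZ.summable_abs]
        exact ENNReal.ofReal_lt_top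

lemma enorm_integral_sq_le (hZ : IsSphericalWhiteNoise Y C μ Z) (t : ℤ) (x : S2) :
    ‖∫ ω, ‖Z x t ω ^ 2‖ ∂μ‖ₑ ≤ ∑' ℓ, ENNReal.ofReal (|C ℓ| * zonalKernel Y ℓ x x) := by
  have hcov : ∫ ω, ‖Z x t ω ^ 2‖ ∂μ = ∑' ℓ, C ℓ * zonalKernel Y ℓ x x := by
    rw [(hZ.spectrum t x x).tsum_eq, cov]
    exact integral_congr_ae (ae_of_all _ fun ω => by simp [sq])
  have habs : ∀ ℓ, ‖C ℓ * zonalKernel Y ℓ x x‖ = |C ℓ| * zonalKernel Y ℓ x x := fun ℓ => by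
    rw [norm_mul, Real.norm_of_nonneg (zonalKernel_self_nonneg Y ℓ x), Real.norm_eq_abs]
  have hs : Summable fun ℓ => ‖C ℓ * zonalKernel Y ℓ x x‖ := (hZ.spectrum t x x).summable.norm
  rw [hcov, ← ofReal_norm]
  simp_rw [← habs]
  rw [← ENNReal.ofReal_tsum_of_nonneg (fun ℓ => norm_nonneg _) hs]
  exact ENNReal.ofReal_le_ofReal (norm_tsum_le_tsum_norm hs)

lemma memLp_prod [IsProbabilityMeasure μ] (hZ : IsSphericalWhiteNoise Y C μ Z)
    (hY : IsHarmonicBasis Y) (t : ℤ) :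
    MemLp (fun q : S2 × Ω => Z q.1 t q.2) 2 (surf.prod μ) := by
  have hm : AEStronglyMeasurable (fun q : S2 × Ω => Z q.1 t q.2) (surf.prod μ) :=
    (hZ.measurable t).aestronglyMeasurable
  have hm2 : AEStronglyMeasurable (fun q : S2 × Ω => Z q.1 t q.2 ^ 2) (surf.prod μ) := hm.pow 2
  have hm3 : AEStronglyMeasurable (fun x => ∫ ω, ‖Z x t ω ^ 2‖ ∂μ) surf :=
    hm2.norm.integral_prod_right'
  have hfin : HasFiniteIntegral (fun x => ∫ ω, ‖Z x t ω ^ 2‖ ∂μ) surf :=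
    (lintegral_mono fun x => hZ.enorm_integral_sq_le t x).trans_lt
      (hZ.lintegral_tsum_abs_zonalKernel_lt_top hY)
  rw [memLp_two_iff_integrable_sq hm, integrable_prod_iff hm2]
  exact And.intro (ae_of_all _ fun x => (hZ.memLp x t).integrable_sq) (And.intro hm3 hfin)

/-- The spherical harmonics of degree `ℓ` are eigenfunctions of the covariance operator, with
eigenvalue `C ℓ`. -/
lemma integral_cov_mul (hZ : IsSphericalWhiteNoise Y C μ Z) (hY : IsHarmonicBasis Y)
    (t : ℤ) (ℓ : ℕ) (m : Fin (2 * ℓ + 1)) (x : S2) :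
    ∫ y, cov μ Z t x y * Y ℓ m y ∂surf = C ℓ * Y ℓ m x := by
  obtain ⟨M, hM⟩ := isCompact_univ.exists_bound_of_continuousOn (hY.continuous ℓ m).continuousOn
  have hM0 : 0 ≤ M := (norm_nonneg _).trans (hM x trivial)
  have hdiag : ∀ ℓ', Integrable (fun y => zonalKernel Y ℓ' y y) surf := fun ℓ' =>
    integrable_of_continuous ((hY.continuous_zonalKernel ℓ').comp
      (by fun_prop : Continuous fun y : S2 => (y, y)))
  have hint : ∀ ℓ', Integrable (fun y => C ℓ' * zonalKernel Y ℓ' x y * Y ℓ m y) surf := fun ℓ' =>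
    integrable_of_continuous ((continuous_const.mul ((hY.continuous_zonalKernel ℓ').comp
      (by fun_prop : Continuous fun y : S2 => (x, y)))).mul (hY.continuous ℓ m))
  have hsum : Summable fun ℓ' => ∫ y, ‖C ℓ' * zonalKernel Y ℓ' x y * Y ℓ m y‖ ∂surf := by
    have h1 : Summable fun ℓ' => |C ℓ'| * zonalKernel Y ℓ' x x :=
      (hZ.spectrum t x x).summable.abs.congr fun ℓ' => by
        rw [abs_mul, abs_of_nonneg (zonalKernel_self_nonneg Y ℓ' x)]
    refine Summable.of_nonneg_of_le (fun _ => integral_nonneg fun _ => norm_nonneg _) (fun ℓ' => ?_)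
      (((h1.mul_left (surf.real Set.univ)).add hZ.summable_abs).mul_left (M / 2))
    calc _ ≤ ∫ y, |C ℓ'| * ((zonalKernel Y ℓ' x x + zonalKernel Y ℓ' y y) / 2) * M ∂surf := by
          refine integral_mono_of_nonneg (ae_of_all _ fun _ => norm_nonneg _)
            (((((integrable_const _).add (hdiag ℓ')).div_const 2).const_mul _).mul_const M)
            (ae_of_all _ fun y => ?_)
          simp only [norm_mul]
          exact mul_le_mul (mul_le_mul_of_nonneg_left (abs_zonalKernel_le Y ℓ' x y) (norm_nonneg _))
            (hM y trivial) (norm_nonneg _) (mul_nonneg (abs_nonneg _)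
              ((abs_nonneg _).trans (abs_zonalKernel_le Y ℓ' x y)))
      _ = _ := by
          rw [integral_mul_const, integral_const_mul, integral_div,
            integral_add (integrable_const _) (hdiag ℓ'), hY.integral_zonalKernel_self,
            integral_const, smul_eq_mul]
          ring
  have h := hasSum_integral_of_summable_integral_norm hint hsum
  have htsum : ∀ y, ∑' ℓ', C ℓ' * zonalKernel Y ℓ' x y * Y ℓ m y = cov μ Z t x y * Y ℓ m y :=
    fun y => ((hZ.spectrum t x y).mul_right _).tsum_eq
  simp_rw [htsum, mul_assoc, integral_const_mul, hY.integral_zonalKernel_mul] at h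
  refine h.unique ?_
  have h1 := hasSum_single (f := fun ℓ' => C ℓ' * if ℓ' = ℓ then Y ℓ m x else 0) ℓ
    (fun ℓ' hℓ' => by simp [hℓ'])
  simpa using h1

lemma memLp_coeff [IsProbabilityMeasure μ] (hZ : IsSphericalWhiteNoise Y C μ Z)
    (hY : IsHarmonicBasis Y) (ℓ : ℕ) (m : Fin (2 * ℓ + 1)) (t : ℤ) :
    MemLp (coeff Y Z ℓ m t) 2 μ :=
  memLp_integral_mul (X := fun x => Z x t) (hZ.memLp_prod hY t) (memLp_two_of_continuous (hY.continuous ℓ m))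

lemma integral_mul_of_ne [IsProbabilityMeasure μ] (hZ : IsSphericalWhiteNoise Y C μ Z) {s t : ℤ}
    (hst : s ≠ t) (x y : S2) : ∫ ω, Z x s ω * Z y t ω ∂μ = 0 := by
  have h := (hZ.indep.indepFun hst).comp (measurable_pi_apply x) (measurable_pi_apply y)
  refine (IndepFun.integral_fun_mul_eq_mul_integral h (hZ.memLp x s).1 (hZ.memLp y t).1).trans ?_
  exact mul_eq_zero_of_left (hZ.centered x s) _

/-- The harmonic coefficients of degree `ℓ` of the noise are uncorrelated with variance `C ℓ`. -/
lemma integral_coeff_mul_coeff [IsProbabilityMeasure μ] (hZ : IsSphericalWhiteNoise Y C μ Z)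
    (hY : IsHarmonicBasis Y) (ℓ : ℕ) (m m' : Fin (2 * ℓ + 1)) (s t : ℤ) :
    ∫ ω, coeff Y Z ℓ m s ω * coeff Y Z ℓ m' t ω ∂μ = if s = t ∧ m = m' then C ℓ else 0 := by
  have hYm := fun m => memLp_two_of_continuous (hY.continuous ℓ m)
  have h1 : ∀ x, ∫ ω, Z x s ω * coeff Y Z ℓ m' t ω ∂μ = if s = t then C ℓ * Y ℓ m' x else 0 := by
    intro x
    simp_rw [mul_comm (Z x s _)]
    simp only [coeff]
    rw [integral_integral_mul_mul (X := fun x => Z x t) (hZ.memLp_prod hY t) (hYm m') (hZ.memLp x s)]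
    split_ifs with hst
    · subst hst
      rw [← hZ.integral_cov_mul hY s ℓ m' x]
      simp only [cov, mul_comm]
    · simp [hZ.integral_mul_of_ne (Ne.symm hst)]
  have h2 := integral_integral_mul_mul (X := fun x => Z x s) (hZ.memLp_prod hY s) (hYm m) (hZ.memLp_coeff hY ℓ m' t)
  refine h2.trans ?_
  simp_rw [h1]
  by_cases hst : s = t
  · simp_rw [if_pos hst, mul_assoc, integral_const_mul, hY.integral_mul]
    by_cases hm : m = m' <;> simp [hst, hm, eq_comm]
  · simp [hst]

lemma spectrum_nonneg [IsProbabilityMeasure μ] (hZ : IsSphericalWhiteNoise Y C μ Z)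
    (hY : IsHarmonicBasis Y) (ℓ : ℕ) : 0 ≤ C ℓ := by
  have h := hZ.integral_coeff_mul_coeff hY ℓ 0 0 0 0
  rw [if_pos ⟨rfl, rfl⟩] at h
  rw [← h]
  exact integral_nonneg fun ω => mul_self_nonneg _

/-- Identifiability, tested on `Y_{ℓ,0}`, makes the angular power spectrum positive. -/
lemma spectrum_pos [IsProbabilityMeasure μ] (hZ : IsSphericalWhiteNoise Y C μ Z)
    (hY : IsHarmonicBasis Y) (hI : Identifiable μ Z) (ℓ : ℕ) : 0 < C ℓ := by
  have hne : ¬ Y ℓ 0 =ᵐ[surf] 0 := by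
    intro h
    have h1 := hY.normalized ℓ 0
    rw [integral_congr_ae (g := fun _ => (0 : ℝ)) (by filter_upwards [h] with x hx; simp [hx])] at h1
    simp at h1
  have hpos := hI 0 (Y ℓ 0) (memLp_two_of_continuous (hY.continuous ℓ 0)) hne
  -- otherwise the integral would have the junk value `0`
  have hint : Integrable (fun q : S2 × S2 => cov μ Z 0 q.1 q.2 * Y ℓ 0 q.1 * Y ℓ 0 q.2)
      (surf.prod surf) := by
    by_contra hc
    rw [integral_undef hc] at hpos
    exact lt_irrefl _ hpos
  rw [integral_prod _ hint] at hpos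
  have h1 : ∀ x, ∫ y, cov μ Z 0 x y * Y ℓ 0 x * Y ℓ 0 y ∂surf = C ℓ * (Y ℓ 0 x * Y ℓ 0 x) := by
    intro x
    simp_rw [mul_right_comm _ (Y ℓ 0 x)]
    rw [integral_mul_const, hZ.integral_cov_mul hY, mul_assoc]
  simp_rw [h1, integral_const_mul] at hpos
  rwa [hY.normalized, mul_one] at hpos

/-- The closed span of the noise, in which the whole autoregression takes place. -/
noncomputable def gaussianSpace (hZ : IsSphericalWhiteNoise Y C μ Z) : Submodule ℝ (Lp ℝ 2 μ) :=
  (Submodule.span ℝ (Set.range fun q : S2 × ℤ => (hZ.memLp q.1 q.2).toLp)).topologicalClosure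

lemma isGaussianSubspace [IsProbabilityMeasure μ] (hZ : IsSphericalWhiteNoise Y C μ Z) :
    IsGaussianSubspace hZ.gaussianSpace :=
  (isGaussianSubspace_span (isGaussianProcess_prod_of_iIndepFun
    (X := fun (t : ℤ) (x : S2) => Z x t) hZ.gaussian hZ.indep) (fun q => hZ.centered q.1 q.2)
    (fun q => hZ.memLp q.1 q.2)).topologicalClosure

lemma toLp_coeff_mem_gaussianSpace [IsProbabilityMeasure μ] (hZ : IsSphericalWhiteNoise Y C μ Z)
    (hY : IsHarmonicBasis Y) (ℓ : ℕ) (m : Fin (2 * ℓ + 1)) (t : ℤ) :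
    (hZ.memLp_coeff hY ℓ m t).toLp ∈ hZ.gaussianSpace := by
  refine Submodule.topologicalClosure_mono ?_ (toLp_integral_mul_mem_closure_span
    (X := fun x => Z x t) (hZ.memLp_prod hY t) (memLp_two_of_continuous (hY.continuous ℓ m)) fun x => hZ.memLp x t)
  refine Submodule.span_mono ?_
  rintro _ ⟨x, rfl⟩
  exact ⟨(x, t), rfl⟩

end IsSphericalWhiteNoise

namespace IsIsotropicStationaryField

lemma memLp (hT : IsIsotropicStationaryField μ T) (x : S2) (t : ℤ) : MemLp (T x t) 2 μ :=
  (hT.gaussian.hasGaussianLaw_eval (x, t)).memLp_two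

lemma integral_sq_eq (hT : IsIsotropicStationaryField μ T) (x : S2) (t : ℤ) :
    ∫ ω, T x t ω ^ 2 ∂μ = ∫ ω, T x 0 ω ^ 2 ∂μ := by
  have h := (hT.invariant (LinearIsometryEquiv.refl ℝ E3) (by simp [IsRotation]) t).comp
    (u := fun f : S2 × ℤ → ℝ => f (x, 0) ^ 2) (by fun_prop)
  have h1 := h.integral_eq
  simpa [Function.comp_def, rotate] using h1

/-- Mean-square continuity makes the variance of the field bounded on the (compact) sphere. -/
lemma exists_integral_sq_le (hT : IsIsotropicStationaryField μ T) :
    ∃ K, ∀ x t, ∫ ω, T x t ω ^ 2 ∂μ ≤ K := by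
  suffices h : ∃ K, ∀ x ∈ (Set.univ : Set S2), ∫ ω, T x 0 ω ^ 2 ∂μ ≤ K by
    obtain ⟨K, hK⟩ := h
    exact ⟨K, fun x t => (hT.integral_sq_eq x t).trans_le (hK x trivial)⟩
  refine isCompact_univ.induction_on (p := fun s : Set S2 => ∃ K, ∀ x ∈ s, ∫ ω, T x 0 ω ^ 2 ∂μ ≤ K)
    ⟨0, by simp⟩ (fun s s' hss' ⟨K, hK⟩ => ⟨K, fun x hx => hK x (hss' hx)⟩)
    (fun s s' ⟨K, hK⟩ ⟨K', hK'⟩ => ⟨max K K', fun x hx => ?_⟩) (fun x _ => ?_)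
  · rcases hx with hx | hx
    · exact (hK x hx).trans (le_max_left _ _)
    · exact (hK' x hx).trans (le_max_right _ _)
  · have h := (hT.meanSquareContinuous x 0).eventually (eventually_lt_nhds zero_lt_one)
    refine ⟨_, nhdsWithin_le_nhds h, 2 * (1 + ∫ ω, T x 0 ω ^ 2 ∂μ), fun y hy => ?_⟩
    have hd : Integrable (fun ω => (T y 0 ω - T x 0 ω) ^ 2) μ :=
      ((hT.memLp y 0).sub (hT.memLp x 0)).integrable_sq
    have hx := (hT.memLp x 0).integrable_sq
    calc _ ≤ ∫ ω, 2 * ((T y 0 ω - T x 0 ω) ^ 2 + T x 0 ω ^ 2) ∂μ :=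
          integral_mono (hT.memLp y 0).integrable_sq ((hd.add hx).const_mul 2) fun ω => by
            show T y 0 ω ^ 2 ≤ 2 * ((T y 0 ω - T x 0 ω) ^ 2 + T x 0 ω ^ 2)
            nlinarith [sq_nonneg (T y 0 ω - 2 * T x 0 ω)]
      _ ≤ _ := by
          rw [integral_const_mul, integral_add hd hx]
          have : ∫ ω, (T y 0 ω - T x 0 ω) ^ 2 ∂μ < 1 := hy
          linarith

lemma memLp_prod [IsProbabilityMeasure μ] (hT : IsIsotropicStationaryField μ T) (t : ℤ) :
    MemLp (fun q : S2 × Ω => T q.1 t q.2) 2 (surf.prod μ) := by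
  have hm : AEStronglyMeasurable (fun q : S2 × Ω => T q.1 t q.2) (surf.prod μ) :=
    (hT.measurable t).aestronglyMeasurable
  have hm2 : AEStronglyMeasurable (fun q : S2 × Ω => T q.1 t q.2 ^ 2) (surf.prod μ) := hm.pow 2
  obtain ⟨K, hK⟩ := hT.exists_integral_sq_le
  rw [memLp_two_iff_integrable_sq hm, integrable_prod_iff hm2]
  refine ⟨ae_of_all _ fun x => (hT.memLp x t).integrable_sq,
    Integrable.of_bound hm2.norm.integral_prod_right' K (ae_of_all _ fun x => ?_)⟩
  rw [Real.norm_of_nonneg (integral_nonneg fun _ => norm_nonneg _)]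
  simpa using hK x t

lemma memLp_coeff [IsProbabilityMeasure μ] (hT : IsIsotropicStationaryField μ T)
    (hY : IsHarmonicBasis Y) (ℓ : ℕ) (m : Fin (2 * ℓ + 1)) (t : ℤ) :
    MemLp (coeff Y T ℓ m t) 2 μ :=
  memLp_integral_mul (X := fun x => T x t) (hT.memLp_prod t) (memLp_two_of_continuous (hY.continuous ℓ m))

lemma exists_norm_toLp_coeff_le [IsProbabilityMeasure μ] (hT : IsIsotropicStationaryField μ T)
    (hY : IsHarmonicBasis Y) (ℓ : ℕ) (m : Fin (2 * ℓ + 1)) :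
    ∃ K, ∀ t, ‖(hT.memLp_coeff hY ℓ m t).toLp‖ ≤ K := by
  refine ⟨√(∫ q, T q.1 0 q.2 ^ 2 ∂(surf.prod μ)), fun t => Real.le_sqrt_of_sq_le ?_⟩
  have h := integral_sq_integral_mul_le (X := fun x => T x t) (hT.memLp_prod t)
    (memLp_two_of_continuous (hY.continuous ℓ m))
  have h1 : ∫ q, T q.1 t q.2 ^ 2 ∂(surf.prod μ) = ∫ q, T q.1 0 q.2 ^ 2 ∂(surf.prod μ) := by
    rw [integral_prod _ (hT.memLp_prod t).integrable_sq,
      integral_prod _ (hT.memLp_prod 0).integrable_sq]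
    exact integral_congr_ae (ae_of_all _ fun x => hT.integral_sq_eq x t)
  have h2 : ∫ x, Y ℓ m x ^ 2 ∂surf = 1 := by simpa only [sq] using hY.normalized ℓ m
  rw [h1, h2, mul_one] at h
  rw [← real_inner_self_eq_norm_sq, inner_toLp_toLp]
  simpa only [sq, coeff] using h

end IsIsotropicStationaryField

lemma inner_sphere_mem_Icc (x y : S2) : inner ℝ (x : E3) (y : E3) ∈ Set.Icc (-1 : ℝ) 1 := by
  have h := abs_real_inner_le_norm (x : E3) (y : E3)
  rw [norm_eq_of_mem_sphere, norm_eq_of_mem_sphere, one_mul] at h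
  exact abs_le.1 h

lemma integrable_kernel_mul {k : ℝ → ℝ} (hk : ContinuousOn k (Set.Icc (-1) 1)) {f y : S2 → ℝ}
    (hf : MemLp f 2 surf) (hy : MemLp y 2 surf) :
    Integrable (fun q : S2 × S2 => k (inner ℝ (q.1 : E3) (q.2 : E3)) * (y q.1 * f q.2))
      (surf.prod surf) := by
  have hc : Continuous fun q : S2 × S2 => k (inner ℝ (q.1 : E3) (q.2 : E3)) :=
    hk.comp_continuous (by fun_prop) fun q => inner_sphere_mem_Icc q.1 q.2
  obtain ⟨M, hM⟩ := isCompact_univ.exists_bound_of_continuousOn hc.continuousOn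
  exact ((hy.integrable (by norm_num)).mul_prod (hf.integrable (by norm_num))).bdd_mul
    (c := M) hc.aestronglyMeasurable (ae_of_all _ fun q => hM q trivial)

/-- An isotropic kernel operator is symmetric, so it acts on harmonic coefficients through its
eigenvalues. -/
lemma HasKernelEigenvalues.integral_kernelOp_mul {k : ℝ → ℝ} {lam : ℕ → ℝ}
    (hk : HasKernelEigenvalues Y k lam) (hY : IsHarmonicBasis Y) {f : S2 → ℝ}
    (hf : MemLp f 2 surf) (ℓ : ℕ) (m : Fin (2 * ℓ + 1)) :
    Integrable (fun x => kernelOp k f x * Y ℓ m x) surf ∧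
      ∫ x, kernelOp k f x * Y ℓ m x ∂surf = lam ℓ * ∫ x, f x * Y ℓ m x ∂surf := by
  have hint := integrable_kernel_mul hk.continuousOn hf
    (memLp_two_of_continuous (hY.continuous ℓ m))
  have h1 : ∀ x, kernelOp k f x * Y ℓ m x
      = ∫ y, k (inner ℝ (x : E3) (y : E3)) * (Y ℓ m x * f y) ∂surf := by
    intro x
    rw [kernelOp, ← integral_mul_const]
    exact integral_congr_ae (ae_of_all _ fun y => by ring)
  simp_rw [h1]
  refine ⟨hint.integral_prod_left, ?_⟩
  rw [integral_integral_swap hint, ← integral_const_mul]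
  refine integral_congr_ae (ae_of_all _ fun y => ?_)
  calc _ = ∫ x, k (inner ℝ (y : E3) (x : E3)) * Y ℓ m x * f y ∂surf := by
        refine integral_congr_ae (ae_of_all _ fun x => ?_)
        simp only
        rw [real_inner_comm]
        ring
    _ = kernelOp k (Y ℓ m) y * f y := by rw [integral_mul_const, kernelOp]
    _ = _ := by rw [hk.eigen]; ring

/-- The harmonic coefficients of degree `ℓ` of a spherical autoregression solve the scalar
autoregression whose parameters are the eigenvalues of the kernels. -/
lemma SolvesAR.coeff_eq [IsProbabilityMeasure μ] {p : ℕ} {k : Fin p → ℝ → ℝ} {φ : ℕ → Fin p → ℝ}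
    (hAR : SolvesAR μ k T Z) (hk : ∀ j, HasKernelEigenvalues Y (k j) (fun ℓ => φ ℓ j))
    (hY : IsHarmonicBasis Y) (hZ : IsSphericalWhiteNoise Y C μ Z)
    (hT : IsIsotropicStationaryField μ T) (ℓ : ℕ) (m : Fin (2 * ℓ + 1)) (t : ℤ) :
    ∀ᵐ ω ∂μ, coeff Y T ℓ m t ω
      = ∑ j : Fin p, φ ℓ j * coeff Y T ℓ m (t - ((j : ℤ) + 1)) ω + coeff Y Z ℓ m t ω := by
  have hTl : ∀ᵐ ω ∂μ, ∀ s, MemLp (fun x => T x s ω) 2 surf :=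
    ae_all_iff.2 fun s => ae_memLp_section (X := fun x => T x s) (hT.memLp_prod s)
  have hYm := memLp_two_of_continuous (hY.continuous ℓ m)
  filter_upwards [hAR t, hTl, ae_memLp_section (X := fun x => Z x t) (hZ.memLp_prod hY t)]
    with ω h hTω hZω
  have hop := fun j : Fin p =>
    (hk j).integral_kernelOp_mul hY (hTω (t - ((j : ℤ) + 1))) ℓ m
  calc coeff Y T ℓ m t ω = ∫ x, (∑ j : Fin p,
        kernelOp (k j) (fun y => T y (t - ((j : ℤ) + 1)) ω) x * Y ℓ m x)
          + Z x t ω * Y ℓ m x ∂surf := by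
        refine integral_congr_ae ?_
        filter_upwards [h] with x hx
        rw [hx, add_mul, Finset.sum_mul]
    _ = _ := by
        have hZY : Integrable (fun x => Z x t ω * Y ℓ m x) surf := hZω.integrable_mul hYm
        rw [integral_add (integrable_finsetSum _ fun j _ => (hop j).1) hZY,
          integral_finsetSum _ fun j _ => (hop j).1]
        simp only [(hop _).2]
        rfl

end Sphere

/-! ### Families of autoregressions with a common polynomial -/

section Family

open Polynomial

variable {H : Type*} [NormedAddCommGroup H] [InnerProductSpace ℝ H]

lemma inner_eq_zero_of_mem_closure_span {A : Set H} {x y : H}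
    (hx : x ∈ (Submodule.span ℝ A).topologicalClosure) (h : ∀ z ∈ A, inner ℝ z y = 0) :
    inner ℝ x y = 0 := by
  have hcl : IsClosed {x : H | inner ℝ x y = 0} := isClosed_eq (by fun_prop) continuous_const
  refine closure_minimal (s := (Submodule.span ℝ A : Set H)) (fun z hz => ?_) hcl hx
  induction hz using Submodule.span_induction with
  | mem z hz => exact h z hz
  | zero => exact inner_zero_left _
  | add z w _ _ hz hw =>
    show inner ℝ (z + w) y = 0
    rw [inner_add_left, show inner ℝ z y = 0 from hz, show inner ℝ w y = 0 from hw, add_zero]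
  | smul c z _ hz =>
    show inner ℝ (c • z) y = 0
    rw [inner_smul_left, show inner ℝ z y = 0 from hz, mul_zero]

variable {ι : Type*} [DecidableEq ι] {a e : ι → ℤ → H} {q : ℝ[X]} {v : ℝ}

lemma inner_eq_zero_of_autoregression (hq : ∀ z : ℂ, ‖z‖ ≤ 1 → aeval z q ≠ 0)
    (hK : ∀ m, ∃ K, ∀ t, ‖a m t‖ ≤ K) (hae : ∀ m, aeval backShift q (a m) = e m)
    (he : ∀ m s m' t, inner ℝ (e m s) (e m' t) = if s = t ∧ m = m' then v else 0)
    (m m' : ι) {s t : ℤ} (hst : s < t) : inner ℝ (a m s) (e m' t) = 0 := by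
  obtain ⟨K, hK⟩ := hK m
  refine inner_eq_zero_of_mem_closure_span
    (mem_closure_span_of_autoregression hq hK (hae m) s) ?_
  rintro _ ⟨r, hr, rfl⟩
  rw [he, if_neg]
  rintro ⟨rfl, -⟩
  exact absurd hst (not_lt.2 hr)

lemma inner_eq_zero_of_autoregression_of_ne (hq : ∀ z : ℂ, ‖z‖ ≤ 1 → aeval z q ≠ 0)
    (hK : ∀ m, ∃ K, ∀ t, ‖a m t‖ ≤ K) (hae : ∀ m, aeval backShift q (a m) = e m)
    (he : ∀ m s m' t, inner ℝ (e m s) (e m' t) = if s = t ∧ m = m' then v else 0)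
    {m m' : ι} (hm : m ≠ m') (s t : ℤ) : inner ℝ (a m s) (a m' t) = 0 := by
  obtain ⟨K, hK1⟩ := hK m
  obtain ⟨K', hK2⟩ := hK m'
  refine inner_eq_zero_of_mem_closure_span
    (mem_closure_span_of_autoregression hq hK1 (hae m) s) ?_
  rintro _ ⟨r, -, rfl⟩
  rw [real_inner_comm]
  refine inner_eq_zero_of_mem_closure_span
    (mem_closure_span_of_autoregression hq hK2 (hae m') t) ?_
  rintro _ ⟨r', -, rfl⟩
  rw [he, if_neg]
  rintro ⟨-, h⟩
  exact hm h.symm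

/-- The covariance matrix of a finite sample from a family of autoregressions with mutually
orthogonal innovations is bounded by `v / m` (cf. `norm_sq_aeval_backShift_le_of_autoregression`).
-/
lemma norm_sq_sum_smul_le_of_autoregression [Fintype ι] (hq : ∀ z : ℂ, ‖z‖ ≤ 1 → aeval z q ≠ 0)
    (hK : ∀ m, ∃ K, ∀ t, ‖a m t‖ ≤ K) (hae : ∀ m, aeval backShift q (a m) = e m) (hv : 0 ≤ v)
    (he : ∀ m s m' t, inner ℝ (e m s) (e m' t) = if s = t ∧ m = m' then v else 0) {c : ℝ}
    (hc : 0 < c) (hcq : ∀ z : ℂ, ‖z‖ = 1 → c ≤ ‖aeval z q‖ ^ 2) {n : ℕ} (hn : 0 < n) (t : ℤ)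
    (u : Fin n × ι → ℝ) :
    ‖∑ j, u j • a j.2 (t + (j.1 : ℕ))‖ ^ 2 ≤ v / c * ∑ j, u j ^ 2 := by
  let b : ι → H := fun m => ∑ r : Fin n, u (r, m) • a m (t + (r : ℕ))
  have hb : ∀ m, ‖b m‖ ^ 2 ≤ v / c * ∑ r : Fin n, u (r, m) ^ 2 := by
    intro m
    -- the coefficients are listed backwards from the last observation, at time `t + n - 1`
    let U : ℝ[X] := ∑ i : Fin n, monomial (i : ℕ) (u (i.rev, m))
    have hcoeff : ∀ i : Fin n, U.coeff i = u (i.rev, m) := by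
      intro i
      simp [U, finsetSum_coeff, coeff_monomial, ← Fin.ext_iff]
    have hdeg : U.natDegree < n := by
      refine (natDegree_sum_le_of_forall_le (n := n - 1) _ _ fun i _ => ?_).trans_lt (by omega)
      exact (natDegree_monomial_le _).trans (by omega)
    obtain ⟨K, hK⟩ := hK m
    have h := norm_sq_aeval_backShift_le_of_autoregression hq hK (hae m) hv
      (fun s t => by rw [he]; simp) hc hcq U (t + n - 1) hdeg
    rw [aeval_backShift_apply U _ _ hdeg, Finset.sum_range, Finset.sum_range] at h
    simp_rw [hcoeff] at h
    rw [← Equiv.sum_comp Fin.revPerm fun i : Fin n => u (i.rev, m) • a m (t + n - 1 - (i : ℕ)),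
      ← Equiv.sum_comp Fin.revPerm fun i : Fin n => u (i.rev, m) ^ 2] at h
    simp only [Fin.revPerm_apply, Fin.rev_rev] at h
    have htime : ∀ r : Fin n, t + n - 1 - (r.rev : ℕ) = t + (r : ℕ) := fun r => by
      rw [Fin.val_rev, Nat.cast_sub (show (r : ℕ) + 1 ≤ n from r.2)]
      push_cast
      ring
    simpa only [htime] using h
  have hsum : ∑ j : Fin n × ι, u j • a j.2 (t + (j.1 : ℕ)) = ∑ m, b m := by
    rw [Fintype.sum_prod_type_right]
  have horth : ∀ m m', m ≠ m' → inner ℝ (b m) (b m') = 0 := by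
    intro m m' hm
    simp only [b, sum_inner, inner_sum, inner_smul_left, inner_smul_right]
    simp only [inner_eq_zero_of_autoregression_of_ne hq hK hae he hm, mul_zero,
      Finset.sum_const_zero]
  rw [hsum, ← real_inner_self_eq_norm_sq, sum_inner, Fintype.sum_prod_type_right, Finset.mul_sum]
  refine Finset.sum_le_sum fun m _ => ?_
  rw [inner_sum, Finset.sum_eq_single m (fun m' _ h => horth m m' h.symm) (by simp),
    real_inner_self_eq_norm_sq]
  exact hb m

end Family

/-! ### The score of the least squares problem -/

section Score

open Polynomial

/-- The polynomial `1 - φ₁ z - ⋯ - φ_p z^p` with real coefficients. -/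
noncomputable def realArPoly {p : ℕ} (φ : Fin p → ℝ) : ℝ[X] :=
  1 - ∑ j : Fin p, C (φ j) * X ^ ((j : ℕ) + 1)

lemma aeval_realArPoly {p : ℕ} (φ : Fin p → ℝ) (z : ℂ) : aeval z (realArPoly φ) = arPoly φ z := by
  simp [realArPoly, arPoly]

lemma aeval_backShift_realArPoly {H : Type*} [NormedAddCommGroup H] [InnerProductSpace ℝ H] {p : ℕ}
    (φ : Fin p → ℝ) (x : ℤ → H) (t : ℤ) :
    aeval backShift (realArPoly φ) x t = x t - ∑ j : Fin p, φ j • x (t - ((j : ℤ) + 1)) := by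
  simp only [realArPoly, map_sub, map_one, map_sum, map_mul, aeval_C, map_pow, aeval_X,
    LinearMap.sub_apply, LinearMap.sum_apply, Module.End.mul_apply, Pi.sub_apply,
    Finset.sum_apply, Module.algebraMap_end_apply, Pi.smul_apply, backShift_pow_apply,
    Module.End.one_apply]
  push_cast
  rfl

lemma muMin_le {p : ℕ} (φ : Fin p → ℝ) {z : ℂ} (hz : ‖z‖ = 1) : muMin φ ≤ ‖arPoly φ z‖ ^ 2 :=
  csInf_le ⟨0, by rintro _ ⟨w, -, rfl⟩; positivity⟩ ⟨z, hz, rfl⟩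

lemma muMin_pos {p : ℕ} {φ : Fin p → ℝ} (h : ∀ z : ℂ, ‖z‖ ≤ 1 → arPoly φ z ≠ 0) :
    0 < muMin φ := by
  have hc : IsCompact ((fun z : ℂ => ‖arPoly φ z‖ ^ 2) '' {z | ‖z‖ = 1}) := by
    refine IsCompact.image ?_ ?_
    · have : {z : ℂ | ‖z‖ = 1} = Metric.sphere 0 1 := by ext; simp
      rw [this]
      exact isCompact_sphere 0 1
    · unfold arPoly
      fun_prop
  obtain ⟨z, hz, hz'⟩ := hc.sInf_mem ⟨_, 1, by simp, rfl⟩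
  rw [muMin, ← hz']
  have := norm_pos_iff.2 (h z (le_of_eq hz))
  positivity

lemma muMax_nonneg {p : ℕ} (φ : Fin p → ℝ) : 0 ≤ muMax φ :=
  Real.sSup_nonneg (by rintro _ ⟨w, -, rfl⟩; positivity)

variable {Ω : Type*} [MeasurableSpace Ω] {μ : Measure Ω} [IsProbabilityMeasure μ]
  {Y : (ℓ : ℕ) → Fin (2 * ℓ + 1) → S2 → ℝ} {p : ℕ} {k : Fin p → ℝ → ℝ} {φ : ℕ → Fin p → ℝ}
  {C : ℕ → ℝ} {T Z : S2 → ℤ → Ω → ℝ}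

/-- The sum `∑ a_{ℓ,m}(t - (h + 1)) ε_{ℓ,m}(t)` over the times `t = p + 1, …, p + N` and over `m`,
where `ε_{ℓ,m}` are the coefficients of the noise: up to normalization, the component of
`γ̂ - Γ̂ φ` of lag `h + 1`. -/
noncomputable def score (Y : (ℓ : ℕ) → Fin (2 * ℓ + 1) → S2 → ℝ) (T Z : S2 → ℤ → Ω → ℝ)
    (p N ℓ h : ℕ) (ω : Ω) : ℝ :=
  ∑ j : Fin N × Fin (2 * ℓ + 1),
    coeff Y T ℓ j.2 ((p : ℤ) - h + (j.1 : ℕ)) ω * coeff Y Z ℓ j.2 ((p : ℤ) + 1 + (j.1 : ℕ)) ω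

/-- The components of `γ̂ - Γ̂ φ` are the normalized scores, by the autoregressive equation for the
harmonic coefficients. -/
lemma ae_gammaHat_sub_eq (hY : IsHarmonicBasis Y)
    (hk : ∀ j, HasKernelEigenvalues Y (k j) (fun ℓ => φ ℓ j))
    (hZ : IsSphericalWhiteNoise Y C μ Z) (hT : IsIsotropicStationaryField μ T)
    (hAR : SolvesAR μ k T Z) (N : ℕ) :
    ∀ᵐ ω ∂μ, ∀ (ℓ : ℕ) (h : Fin p),
      (gammaHat Y T p N ℓ ω - (GammaHat Y T p N ℓ ω).mulVec (φ ℓ)) h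
        = ((N : ℝ) * (2 * (ℓ : ℝ) + 1))⁻¹ * score Y T Z p N ℓ h ω := by
  have hae : ∀ᵐ ω ∂μ, ∀ (ℓ : ℕ) (m : Fin (2 * ℓ + 1)) (t : ℤ), coeff Y T ℓ m t ω
      = ∑ j : Fin p, φ ℓ j * coeff Y T ℓ m (t - ((j : ℤ) + 1)) ω + coeff Y Z ℓ m t ω :=
    ae_all_iff.2 fun ℓ => ae_all_iff.2 fun m => ae_all_iff.2 fun t =>
      hAR.coeff_eq hk hY hZ hT ℓ m t
  filter_upwards [hae] with ω hω ℓ h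
  have hres : ∀ r, respVec Y T p N ℓ ω r - (design Y T p N ℓ ω).mulVec (φ ℓ) r
      = coeff Y Z ℓ r.1 (((N : ℤ) + p) - (r.2 : ℕ)) ω := by
    intro r
    rw [respVec, hω ℓ r.1, Matrix.mulVec, dotProduct]
    simp only [design, Matrix.of_apply, mul_comm (φ ℓ _)]
    ring
  rw [gammaHat, GammaHat, Matrix.smul_mulVec, ← Matrix.mulVec_mulVec, ← smul_sub,
    ← Matrix.mulVec_sub, Pi.smul_apply, smul_eq_mul]
  congr 1
  rw [Matrix.mulVec, dotProduct, score]
  simp only [Pi.sub_apply, hres, Matrix.transpose_apply]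
  simp only [design, Matrix.of_apply]
  rw [Fintype.sum_prod_type, Fintype.sum_prod_type_right]
  refine Finset.sum_congr rfl fun m _ => ?_
  -- the sample is listed backwards in time, the score forwards
  rw [← Equiv.sum_comp Fin.revPerm]
  refine Finset.sum_congr rfl fun r _ => ?_
  have e1 : ((N : ℤ) + p) - ((Fin.revPerm r : Fin N) : ℕ) = (p : ℤ) + 1 + (r : ℕ) := by
    rw [Fin.revPerm_apply, Fin.val_rev, Nat.cast_sub (show (r : ℕ) + 1 ≤ N from r.2)]
    push_cast
    ring
  rw [e1, show (p : ℤ) + 1 + (r : ℕ) - ((h : ℤ) + 1) = (p : ℤ) - (h : ℕ) + (r : ℕ) by ring]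

/-- The tail of the score: its variance proxy is `C_ℓ² / μ_min` times the number of summands. -/
lemma measure_lt_abs_score_le (hY : IsHarmonicBasis Y)
    (hk : ∀ j, HasKernelEigenvalues Y (k j) (fun ℓ => φ ℓ j))
    (hZ : IsSphericalWhiteNoise Y C μ Z) (hT : IsIsotropicStationaryField μ T)
    (hAR : SolvesAR μ k T Z) (hφ : Stationary φ) {N : ℕ} (hN : 0 < N) (ℓ h : ℕ) {t y : ℝ}
    (ht : 0 < t) (ht8 : 8 * (t ^ 2 * (C ℓ * (C ℓ / muMin (φ ℓ)))) ≤ 1) :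
    μ {ω | y < |score Y T Z p N ℓ h ω|} ≤ ENNReal.ofReal (2 * Real.exp
      (2 * (t ^ 2 * (C ℓ * (C ℓ / muMin (φ ℓ)))) * (N * (2 * ℓ + 1)) - t * y)) := by
  let α : Fin (2 * ℓ + 1) → ℤ → Lp ℝ 2 μ := fun m t => (hT.memLp_coeff hY ℓ m t).toLp
  let ε : Fin (2 * ℓ + 1) → ℤ → Lp ℝ 2 μ := fun m t => (hZ.memLp_coeff hY ℓ m t).toLp
  have hG := hZ.isGaussianSubspace
  have hq : ∀ z : ℂ, ‖z‖ ≤ 1 → aeval z (realArPoly (φ ℓ)) ≠ 0 := fun z hz => by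
    rw [aeval_realArPoly]; exact hφ ℓ z hz
  have hμ : 0 < muMin (φ ℓ) := muMin_pos (hφ ℓ)
  have hC : 0 ≤ C ℓ := hZ.spectrum_nonneg hY ℓ
  have hK : ∀ m, ∃ K, ∀ t, ‖α m t‖ ≤ K := fun m => hT.exists_norm_toLp_coeff_le hY ℓ m
  have hae : ∀ m, aeval backShift (realArPoly (φ ℓ)) (α m) = ε m := by
    intro m
    funext t
    rw [aeval_backShift_realArPoly, sub_eq_iff_eq_add']
    refine Lp.ext ?_
    have h1 : ∀ᵐ ω ∂μ, ∀ t, α m t ω = coeff Y T ℓ m t ω :=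
      ae_all_iff.2 fun t => (hT.memLp_coeff hY ℓ m t).coeFn_toLp
    filter_upwards [h1, (hZ.memLp_coeff hY ℓ m t).coeFn_toLp, hAR.coeff_eq hk hY hZ hT ℓ m t,
      Lp.coeFn_add (∑ j : Fin p, φ ℓ j • α m (t - ((j : ℤ) + 1))) (ε m t),
      coeFn_sum_smul (φ ℓ) fun j => α m (t - ((j : ℤ) + 1))] with ω e1 e2 e3 e4 e5
    rw [e4, Pi.add_apply, e5, e2, e1, e3]
    simp_rw [e1]
  have he : ∀ m s m' t, inner ℝ (ε m s) (ε m' t) = if s = t ∧ m = m' then C ℓ else 0 :=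
    fun m s m' t => by rw [inner_toLp_toLp, hZ.integral_coeff_mul_coeff hY]
  have hεG : ∀ m t, ε m t ∈ hZ.gaussianSpace := hZ.toLp_coeff_mem_gaussianSpace hY ℓ
  have hαG : ∀ m t, α m t ∈ hZ.gaussianSpace := by
    intro m t
    obtain ⟨K, hK⟩ := hK m
    refine Submodule.topologicalClosure_minimal _ (Submodule.span_le.2 ?_)
      (Submodule.isClosed_topologicalClosure _)
      (mem_closure_span_of_autoregression hq hK (hae m) t)
    rintro _ ⟨s, -, rfl⟩
    exact hεG m s
  have hmeas : ∀ m t, Measurable (α m t) ∧ Measurable (ε m t) := fun m t =>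
    ⟨(Lp.stronglyMeasurable _).measurable, (Lp.stronglyMeasurable _).measurable⟩
  have hα := fun m t => (hmeas m t).1
  have hε := fun m t => (hmeas m t).2
  let S : Ω → ℝ := fun ω => ∑ j : Fin N × Fin (2 * ℓ + 1),
    α j.2 ((p : ℤ) - h + (j.1 : ℕ)) ω * ε j.2 ((p : ℤ) + 1 + (j.1 : ℕ)) ω
  have hS : ∀ᵐ ω ∂μ, score Y T Z p N ℓ h ω = S ω := by
    have h1 : ∀ᵐ ω ∂μ, ∀ m t, α m t ω = coeff Y T ℓ m t ω := ae_all_iff.2 fun m =>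
      ae_all_iff.2 fun t => (hT.memLp_coeff hY ℓ m t).coeFn_toLp
    have h2 : ∀ᵐ ω ∂μ, ∀ m t, ε m t ω = coeff Y Z ℓ m t ω := ae_all_iff.2 fun m =>
      ae_all_iff.2 fun t => (hZ.memLp_coeff hY ℓ m t).coeFn_toLp
    filter_upwards [h1, h2] with ω e1 e2
    simp only [score, S, e1, e2]
  have hset : μ {ω | y < |score Y T Z p N ℓ h ω|} = μ {ω | y < |S ω|} := by
    refine measure_congr ?_
    filter_upwards [hS] with ω e
    show (y < |score Y T Z p N ℓ h ω|) = (y < |S ω|)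
    rw [e]
  rw [hset]
  refine measure_lt_abs_le_of_lintegral_exp_le (by fun_prop) ht fun t' ht' => ?_
  have := hG.lintegral_exp_sum_mul_le (X := fun r m => α m ((p : ℤ) - h + (r : ℕ)))
    (E := fun r m => ε m ((p : ℤ) + 1 + (r : ℕ))) (fun r m => hαG _ _) (fun r m => hεG _ _)
    (fun r m r' m' => by rw [he]; simp)
    (fun r m r' m' hr => inner_eq_zero_of_autoregression hq hK hae he m m' (by omega)) N
    (s := C ℓ / muMin (φ ℓ)) (by positivity) hC
    (norm_sq_sum_smul_le_of_autoregression hq hK hae hC he hμ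
      (fun z hz => by rw [aeval_realArPoly]; exact muMin_le _ hz) hN _) (t := t')
      (by rw [ht']; exact ht8)
  rw [ht'] at this
  convert this using 4
  simp

end Score

/-! ### The deviation condition -/

section Deviation

/-- As `1 / √μ ≤ 1 + 1 / μ`, the deviation constant dominates the standard deviation
`C_ℓ / √μ_min` of the score. -/
lemma mul_div_sqrt_le_FN {p : ℕ} {c₀ : ℝ} (hc₀ : 0 ≤ c₀) {φ : ℕ → Fin p → ℝ} {C : ℕ → ℝ}
    {L ℓ : ℕ} (hℓ : ℓ < L) (hC : 0 ≤ C ℓ) (hμ : 0 < muMin (φ ℓ)) :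
    c₀ * (C ℓ / √(muMin (φ ℓ))) ≤ FN c₀ φ C L := by
  refine le_trans ?_ (le_ciSup (f := fun ℓ : Fin L =>
    c₀ * (C ℓ * (1 + (1 + muMax (φ ℓ)) / muMin (φ ℓ)))) (Set.finite_range _).bddAbove ⟨ℓ, hℓ⟩)
  refine mul_le_mul_of_nonneg_left ?_ hc₀
  rw [div_eq_mul_inv]
  refine mul_le_mul_of_nonneg_left ?_ hC
  have hw : 0 < √(muMin (φ ℓ)) := Real.sqrt_pos.2 hμ
  have h1 : (1 + muMax (φ ℓ)) / muMin (φ ℓ) ≥ (√(muMin (φ ℓ)))⁻¹ ^ 2 := by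
    rw [inv_pow, Real.sq_sqrt hμ.le, inv_eq_one_div]
    gcongr
    linarith [muMax_nonneg (φ ℓ)]
  have h2 : 0 < (√(muMin (φ ℓ)))⁻¹ := inv_pos.2 hw
  nlinarith [sq_nonneg ((√(muMin (φ ℓ)))⁻¹ - 1)]

variable {Ω : Type*} [MeasurableSpace Ω] {μ : Measure Ω} [IsProbabilityMeasure μ]
  {Y : (ℓ : ℕ) → Fin (2 * ℓ + 1) → S2 → ℝ} {p : ℕ} {k : Fin p → ℝ → ℝ} {φ : ℕ → Fin p → ℝ}
  {C : ℕ → ℝ} {T Z : S2 → ℤ → Ω → ℝ}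

/-- The Chernoff bound for the score at a threshold of `√(Λ / N)` times the deviation constant. The
parameter is `t = τ √(Λ / N) √μ_min / C_ℓ`, which the condition `8 τ² Λ ≤ N` makes small enough. -/
lemma measure_lt_abs_score_le_exp (hY : IsHarmonicBasis Y)
    (hk : ∀ j, HasKernelEigenvalues Y (k j) (fun ℓ => φ ℓ j))
    (hZ : IsSphericalWhiteNoise Y C μ Z) (hT : IsIsotropicStationaryField μ T)
    (hAR : SolvesAR μ k T Z) (hφ : Stationary φ) (hI : Identifiable μ Z) {N L ℓ : ℕ} (hN : 0 < N)
    (hℓ : ℓ < L) (h : ℕ) {τ Λ : ℝ} (hτ : 0 < τ) (hΛ : 0 < Λ) (hτΛ : 8 * τ ^ 2 * Λ ≤ N) :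
    μ {ω | N * (2 * ℓ + 1) * (FN ((3 + 2 * τ ^ 2) / τ) φ C L * √(Λ / N))
        < |score Y T Z p N ℓ h ω|} ≤ ENNReal.ofReal (2 * Real.exp (-(3 * Λ))) := by
  have hC : 0 < C ℓ := hZ.spectrum_pos hY hI ℓ
  have hμ : 0 < muMin (φ ℓ) := muMin_pos (hφ ℓ)
  have hw : 0 < √(muMin (φ ℓ)) := Real.sqrt_pos.2 hμ
  have hN' : (0 : ℝ) < N := Nat.cast_pos.2 hN
  have hr : 0 < √(Λ / N) := Real.sqrt_pos.2 (by positivity)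
  have hr2 : √(Λ / N) ^ 2 = Λ / N := Real.sq_sqrt (by positivity)
  set F := FN ((3 + 2 * τ ^ 2) / τ) φ C L
  have hF : (3 + 2 * τ ^ 2) / τ * (C ℓ / √(muMin (φ ℓ))) ≤ F :=
    mul_div_sqrt_le_FN (by positivity) hℓ hC.le hμ
  set t : ℝ := τ * √(Λ / N) * (√(muMin (φ ℓ)) / C ℓ) with ht
  have ht2 : t ^ 2 * (C ℓ * (C ℓ / muMin (φ ℓ))) = τ ^ 2 * (Λ / N) := by
    rw [ht, mul_pow, mul_pow, hr2, div_pow, Real.sq_sqrt hμ.le]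
    field_simp
  refine (measure_lt_abs_score_le hY hk hZ hT hAR hφ hN ℓ h (t := t) (by positivity) ?_).trans ?_
  · rw [ht2]
    calc 8 * (τ ^ 2 * (Λ / N)) = 8 * τ ^ 2 * Λ / N := by ring
      _ ≤ 1 := (div_le_one hN').2 hτΛ
  · refine ENNReal.ofReal_le_ofReal ?_
    gcongr
    rw [ht2]
    have h1 : (3 + 2 * τ ^ 2) * (Λ / N) ≤ t * (F * √(Λ / N)) := by
      calc (3 + 2 * τ ^ 2) * (Λ / N) = (3 + 2 * τ ^ 2) * √(Λ / N) ^ 2 := by rw [hr2]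
        _ = t * ((3 + 2 * τ ^ 2) / τ * (C ℓ / √(muMin (φ ℓ))) * √(Λ / N)) := by
            rw [ht]
            field_simp
        _ ≤ _ := by gcongr
    have hM : (0 : ℝ) ≤ ℓ := Nat.cast_nonneg ℓ
    have h2 : 2 * (τ ^ 2 * (Λ / N)) * (N * (2 * ℓ + 1)) - (N * (2 * ℓ + 1))
        * ((3 + 2 * τ ^ 2) * (Λ / N)) = -(3 * Λ) - 6 * (ℓ * Λ) := by
      field_simp
      ring
    have h3 : (N * (2 * ℓ + 1)) * ((3 + 2 * τ ^ 2) * (Λ / N))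
        ≤ (N * (2 * ℓ + 1)) * (t * (F * √(Λ / N))) :=
      mul_le_mul_of_nonneg_left h1 (by positivity)
    have h4 : 0 ≤ ℓ * Λ := by positivity
    linarith

end Deviation

end SPHAR

theorem mainTheorem4 (κ : ℝ) (hκ : 0 < κ) :
    ∃ c₀ c₁ c₂ : ℝ, 0 < c₀ ∧ 0 < c₁ ∧ 0 < c₂ ∧
      ∀ (Ω : Type*) [MeasurableSpace Ω] (μ : Measure Ω) [IsProbabilityMeasure μ]
        (Y : (ℓ : ℕ) → Fin (2 * ℓ + 1) → SPHAR.S2 → ℝ) (p : ℕ) (k : Fin p → ℝ → ℝ)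
        (φ : ℕ → Fin p → ℝ) (C : ℕ → ℝ) (T Z : SPHAR.S2 → ℤ → Ω → ℝ) (N L : ℕ),
        SPHAR.IsHarmonicBasis Y →
        0 < p →
        (∀ j, SPHAR.HasKernelEigenvalues Y (k j) (fun ℓ => φ ℓ j)) →
        SPHAR.IsSphericalWhiteNoise Y C μ Z →
        SPHAR.IsIsotropicStationaryField μ T →
        SPHAR.SolvesAR μ k T Z →
        SPHAR.Identifiable μ Z →
        SPHAR.Stationary φ →
        0 < N →
        0 < L →
        κ * Real.log ((p : ℝ) * L) ≤ N →
        1 - c₁ * Real.exp (-(c₂ * Real.log ((p : ℝ) * L))) ≤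
          μ.real {ω | ∀ ℓ < L,
            ‖SPHAR.gammaHat Y T p N ℓ ω - (SPHAR.GammaHat Y T p N ℓ ω).mulVec (φ ℓ)‖ ≤
              SPHAR.FN c₀ φ C L * √(Real.log ((p : ℝ) * L) / N)} := by
  -- `8 τ² = κ` is the largest parameter for which the Chernoff bound applies whenever
  -- `κ log (p L) ≤ N`
  set τ : ℝ := √(κ / 8) with hτ_def
  have hτ : 0 < τ := Real.sqrt_pos.2 (by positivity)
  have hτ2 : 8 * τ ^ 2 = κ := by rw [hτ_def, Real.sq_sqrt (by positivity)]; ring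
  refine ⟨(3 + 2 * τ ^ 2) / τ, 2, 2, by positivity, by norm_num, by norm_num, ?_⟩
  intro Ω _ μ _ Y p k φ C T Z N L hY hp hk hZ hT hAR hI hφ hN hL hκN
  set Λ : ℝ := Real.log ((p : ℝ) * L) with hΛ_def
  have hpL : (1 : ℝ) ≤ (p : ℝ) * L := by exact_mod_cast Nat.mul_pos hp hL
  rcases (Real.log_nonneg hpL).eq_or_lt with h0 | hΛ
  · -- for `p = L = 1` the lower bound is negative
    rw [hΛ_def, ← h0]
    simp only [mul_zero, neg_zero, Real.exp_zero, mul_one]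
    exact le_trans (by norm_num) measureReal_nonneg
  set F := SPHAR.FN ((3 + 2 * τ ^ 2) / τ) φ C L with hF_def
  have hN' : (0 : ℝ) < N := Nat.cast_pos.2 hN
  have hF0 : 0 ≤ F := by
    have hC := hZ.spectrum_nonneg hY 0
    exact le_trans (by positivity)
      (SPHAR.mul_div_sqrt_le_FN (c₀ := (3 + 2 * τ ^ 2) / τ) (by positivity) hL hC
        (SPHAR.muMin_pos (hφ 0)))
  set good : Set Ω := {ω | ∀ ℓ < L,
    ‖SPHAR.gammaHat Y T p N ℓ ω - (SPHAR.GammaHat Y T p N ℓ ω).mulVec (φ ℓ)‖ ≤ F * √(Λ / N)}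
  let bad : ℕ → Fin p → Set Ω := fun ℓ h =>
    {ω | N * (2 * ℓ + 1) * (F * √(Λ / N)) < |SPHAR.score Y T Z p N ℓ h ω|}
  have hbad : ∀ ℓ ∈ Finset.range L, ∀ h, μ (bad ℓ h) ≤ ENNReal.ofReal (2 * Real.exp (-(3 * Λ))) :=
    fun ℓ hℓ h => SPHAR.measure_lt_abs_score_le_exp hY hk hZ hT hAR hφ hI hN
      (Finset.mem_range.1 hℓ) h hτ hΛ (by rw [hτ2]; exact hκN)
  have hcover : ∀ᵐ ω ∂μ, ω ∈ good ∪ ⋃ ℓ ∈ Finset.range L, ⋃ h, bad ℓ h := by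
    filter_upwards [SPHAR.ae_gammaHat_sub_eq hY hk hZ hT hAR N] with ω hω
    by_contra hc
    simp only [Set.mem_union, Set.mem_iUnion, not_or, not_exists] at hc
    refine hc.1 fun ℓ hℓ => (pi_norm_le_iff_of_nonneg (by positivity)).2 fun h => ?_
    have h1 : |SPHAR.score Y T Z p N ℓ h ω| ≤ N * (2 * ℓ + 1) * (F * √(Λ / N)) :=
      not_lt.1 (hc.2 ℓ (Finset.mem_range.2 hℓ) h)
    have h2 : (0 : ℝ) < N * (2 * ℓ + 1) := by positivity
    rw [hω ℓ h, norm_mul, norm_inv, Real.norm_of_nonneg h2.le, Real.norm_eq_abs,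
      inv_mul_le_iff₀ h2]
    exact h1
  have hone : (1 : ENNReal) ≤ μ good + ENNReal.ofReal (2 * Real.exp (-(2 * Λ))) := by
    calc (1 : ENNReal) = μ (good ∪ ⋃ ℓ ∈ Finset.range L, ⋃ h, bad ℓ h) := by
          rw [measure_eq_measure_of_null_sdiff (Set.subset_univ _) ?_, measure_univ]
          rw [← Set.compl_eq_univ_sdiff]
          exact hcover
      _ ≤ μ good + ∑ ℓ ∈ Finset.range L, ∑ h, μ (bad ℓ h) :=
          (measure_union_le _ _).trans (add_le_add_right ((measure_biUnion_finset_le _ _).trans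
            (Finset.sum_le_sum fun ℓ _ => measure_iUnion_fintype_le _ _)) _)
      _ ≤ μ good + ∑ _ℓ ∈ Finset.range L, ∑ _h : Fin p,
            ENNReal.ofReal (2 * Real.exp (-(3 * Λ))) := by
          gcongr with ℓ hℓ h
          exact hbad ℓ hℓ h
      _ = μ good + ENNReal.ofReal (2 * Real.exp (-(2 * Λ))) := by
          congr 1
          rw [Finset.sum_const, Finset.sum_const, Finset.card_univ, Fintype.card_fin,
            Finset.card_range, smul_smul, ← ENNReal.ofReal_nsmul, nsmul_eq_mul]
          congr 1
          have hexp : (p : ℝ) * L = Real.exp Λ := (Real.exp_log (by linarith)).symm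
          push_cast
          rw [mul_comm (L : ℝ), hexp, mul_left_comm, ← Real.exp_add]
          ring_nf
  have h3 := ENNReal.toReal_mono (by finiteness) hone
  rw [ENNReal.toReal_add (by finiteness) (by finiteness), ENNReal.toReal_one,
    ENNReal.toReal_ofReal (by positivity)] at h3
  rw [measureReal_def]
  linarith
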